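/- Fix a number $M\ge 1$ of players. A penalty game consists of an integer $n\ge 1$ (the number of pure strategies of each player), payoff tables $A_i:[n]^M\to[0,1]$ and penalty functions $f_i:\Delta^n\to\mathbb R$ for $i\in[M]$, where $\Delta^n$ is the simplex of mixed strategies. At a profile $\mathbf x=(x_1,\dots,x_M)\in(\Delta^n)^M$ the utility of player $i$ is $$T_i(\mathbf x)=\sum_{a\in[n]^M}A_i(a)\prod_{j}x_j(a_j)-f_i(x_i);$$ for $M=2$ these are $x^TRy-f_r(x)$ and $x^TCy-f_c(y)$. The profile $\mathbf x$ is an exact equilibrium if no player can increase the own utility by a unilateral change of strategy, and a $\delta$-equilibrium if no player can increase it by more than $\delta$. For $2\le p<\infty$ and $\lambda\ge 0$ the penalty functions are $\lambda_p$-Lipschitz if $|f_i(x)-f_i(y)|\le\lambda\|x-y\|_p$ for all $i$ and all $x,y\in\Delta^n$. Algorithms are programs for a real random access machine, with unit cost for exact arithmetic operations and comparisons of reals and for addition, subtraction and comparison of natural numbers, whose input is $n$, $\varepsilon$ and $\lambda$, and which can look up payoff entries and evaluate penalty functions at vectors in its memory (at the cost of reading the arguments). **Theorem.** For every $M\ge1$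 there are an algorithm and a constant $K$, depending only on $M$, such that for all $n\ge 1$, $2\le p<\infty$, $\lambda\ge 0$, $\varepsilon>0$ and every $M$-player penalty game with $n$ pure strategies per player, payoffs in $[0,1]$ and $\lambda_p$-Lipschitz penalty functions, the algorithm halts after at most $$(n+1)^{K(1+\lambda^2)(1+1/\varepsilon^2)\log(n+1)}$$ steps (which is quasi-polynomial in $n$ for fixed $M,\lambda,\varepsilon$), and it either outputs a $3\varepsilon$-equilibrium, or correctly reports that the game has no exact equilibrium. -/

import Mathlib

namespace PenaltyGames

/-! ### Penalty games -/

/-- The `p`-norm `(∑ |x_i|^p)^(1/p)` of a real vector, for a finite exponent `p`. -/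
noncomputable def lpNorm {d : ℕ} (p : ℝ) (x : Fin d → ℝ) : ℝ :=
  (∑ i, |x i| ^ p) ^ (1 / p)

/-- `λ_p`-Lipschitz continuity of `f` on the set `A`. -/
def IsLpLipschitzOn {d : ℕ} (lam p : ℝ) (f : (Fin d → ℝ) → ℝ) (A : Set (Fin d → ℝ)) : Prop :=
  ∀ x ∈ A, ∀ y ∈ A, |f x - f y| ≤ lam * lpNorm p (x - y)

/-- A penalty game with `M` players, each of whom has `n` pure strategies: the payoff tables of the
underlying strategic form game, and one penalty function per player.  Only the values of a penalty
function on the simplex of mixed strategies matter. -/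
structure PenaltyGame (M n : ℕ) where
  payoff : Fin M → (Fin M → Fin n) → ℝ
  penalty : Fin M → (Fin n → ℝ) → ℝ

namespace PenaltyGame

variable {M n : ℕ}

/-- `x` is a profile of mixed strategies. -/
def IsProfile (x : Fin M → Fin n → ℝ) : Prop :=
  ∀ i, x i ∈ stdSimplex ℝ (Fin n)

/-- The expected payoff of player `i` in the underlying strategic form game.  For two players this
is `xᵀ R y` and `xᵀ C y`. -/
def expectedPayoff (G : PenaltyGame M n) (i : Fin M) (x : Fin M → Fin n → ℝ) : ℝ :=
  ∑ a : Fin M → Fin n, (∏ j, x j (a j)) * G.payoff i a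

/-- The utility of player `i`: expected payoff minus the penalty of the player's own strategy. -/
def utility (G : PenaltyGame M n) (i : Fin M) (x : Fin M → Fin n → ℝ) : ℝ :=
  G.expectedPayoff i x - G.penalty i (x i)

/-- Exact equilibria: no player can increase the own utility by a unilateral change. -/
def IsEquilibrium (G : PenaltyGame M n) (x : Fin M → Fin n → ℝ) : Prop :=
  IsProfile x ∧ ∀ i, ∀ z ∈ stdSimplex ℝ (Fin n),
    G.utility i (Function.update x i z) ≤ G.utility i x

/-- `ε`-equilibria: no player can increase the own utility by more than `ε` by a unilateral
change. -/
def IsApproxEquilibrium (G : PenaltyGame M n) (eps : ℝ) (x : Fin M → Fin n → ℝ) : Prop :=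
  IsProfile x ∧ ∀ i, ∀ z ∈ stdSimplex ℝ (Fin n),
    G.utility i (Function.update x i z) - eps ≤ G.utility i x

end PenaltyGame

/-! ### The machine model

A real random access machine, presented as a structured language with loops.  It has
variables and arrays that hold natural numbers, and variables and arrays that hold real numbers.
Natural numbers can be added, subtracted and compared (there is no unit cost multiplication of
natural numbers), and serve as array positions; real numbers can be added, subtracted, multiplied,
divided and compared.  The game is accessed by looking up a payoff entry and by evaluating
a penalty function at a vector that is stored in a real array.  Programs are finite objects, and
their constants are rational. -/

/-- The memory: variables and arrays are named by natural numbers. -/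
structure Store where
  nat : ℕ → ℕ
  real : ℕ → ℝ
  natArr : ℕ → ℕ → ℕ
  realArr : ℕ → ℕ → ℝ

/-- Assignment of `v` to the natural number variable `x`. -/
def Store.setNat (σ : Store) (x v : ℕ) : Store :=
  { σ with nat := Function.update σ.nat x v }

/-- Assignment of `v` to the real variable `x`. -/
noncomputable def Store.setReal (σ : Store) (x : ℕ) (v : ℝ) : Store :=
  { σ with real := Function.update σ.real x v }

/-- Assignment of `v` to position `pos` of the natural number array `a`. -/
def Store.putNat (σ : Store) (a pos v : ℕ) : Store :=
  { σ with natArr := Function.update σ.natArr a (Function.update (σ.natArr a) pos v) }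

/-- Assignment of `v` to position `pos` of the real array `a`. -/
noncomputable def Store.putReal (σ : Store) (a pos : ℕ) (v : ℝ) : Store :=
  { σ with realArr := Function.update σ.realArr a (Function.update (σ.realArr a) pos v) }

/-- Expressions for natural numbers. Subtraction is truncated at `0`. -/
inductive NatExp where
  | lit (c : ℕ)
  | var (x : ℕ)
  | get (a : ℕ) (e : NatExp)
  | add (e₁ e₂ : NatExp)
  | sub (e₁ e₂ : NatExp)

/-- Expressions for real numbers.  `payoff i a` looks up the payoff of player `i` at the pure
profile whose `j`-th component is entry `j` of the natural number array `a`; `penalty i a` evaluates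
the penalty function of player `i` at the first `n` entries of the real array `a`. -/
inductive RealExp (M : ℕ) where
  | lit (q : ℚ)
  | var (x : ℕ)
  | get (a : ℕ) (e : NatExp)
  | add (e₁ e₂ : RealExp M)
  | sub (e₁ e₂ : RealExp M)
  | mul (e₁ e₂ : RealExp M)
  | div (e₁ e₂ : RealExp M)
  | payoff (i : Fin M) (a : ℕ)
  | penalty (i : Fin M) (a : ℕ)

/-- Tests: comparisons of two natural numbers or of two real numbers. -/
inductive Test (M : ℕ) where
  | natLe (e₁ e₂ : NatExp)
  | natLt (e₁ e₂ : NatExp)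
  | realLe (e₁ e₂ : RealExp M)
  | realLt (e₁ e₂ : RealExp M)

/-- Programs: assignments to variables and to array positions, sequencing, branching, and loops
that run as long as a test succeeds. -/
inductive Program (M : ℕ) where
  | skip
  | setNat (x : ℕ) (e : NatExp)
  | setReal (x : ℕ) (e : RealExp M)
  | putNat (a : ℕ) (pos e : NatExp)
  | putReal (a : ℕ) (pos : NatExp) (e : RealExp M)
  | seq (c d : Program M)
  | branch (b : Test M) (c d : Program M)
  | loop (b : Test M) (c : Program M)

def NatExp.eval (σ : Store) : NatExp → ℕ
  | .lit c => c
  | .var x => σ.nat x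
  | .get a e => σ.natArr a (e.eval σ)
  | .add e₁ e₂ => e₁.eval σ + e₂.eval σ
  | .sub e₁ e₂ => e₁.eval σ - e₂.eval σ

/-- Number of steps to evaluate an expression: one per operation. -/
def NatExp.cost : NatExp → ℕ
  | .lit _ => 1
  | .var _ => 1
  | .get _ e => e.cost + 1
  | .add e₁ e₂ => e₁.cost + e₂.cost + 1
  | .sub e₁ e₂ => e₁.cost + e₂.cost + 1

/-- A payoff look-up outside the table returns `0`. -/
noncomputable def RealExp.eval {M n : ℕ} (G : PenaltyGame M n) (σ : Store) : RealExp M → ℝ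
  | .lit q => (q : ℝ)
  | .var x => σ.real x
  | .get a e => σ.realArr a (e.eval σ)
  | .add e₁ e₂ => e₁.eval G σ + e₂.eval G σ
  | .sub e₁ e₂ => e₁.eval G σ - e₂.eval G σ
  | .mul e₁ e₂ => e₁.eval G σ * e₂.eval G σ
  | .div e₁ e₂ => e₁.eval G σ / e₂.eval G σ
  | .payoff i a =>
      if h : ∀ j : Fin M, σ.natArr a j < n then G.payoff i (fun j => ⟨σ.natArr a j, h j⟩) else 0
  | .penalty i a => G.penalty i (fun s => σ.realArr a s)

/-- Number of steps to evaluate an expression: one per arithmetic operation, and one per array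
entry that is passed to a payoff table or to a penalty function. -/
def RealExp.cost {M : ℕ} (n : ℕ) : RealExp M → ℕ
  | .lit _ => 1
  | .var _ => 1
  | .get _ e => e.cost + 1
  | .add e₁ e₂ => e₁.cost n + e₂.cost n + 1
  | .sub e₁ e₂ => e₁.cost n + e₂.cost n + 1
  | .mul e₁ e₂ => e₁.cost n + e₂.cost n + 1
  | .div e₁ e₂ => e₁.cost n + e₂.cost n + 1
  | .payoff _ _ => M + 1
  | .penalty _ _ => n + 1

/-- The test succeeds in the memory `σ`. -/
def Test.Holds {M n : ℕ} (G : PenaltyGame M n) (σ : Store) : Test M → Prop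
  | .natLe e₁ e₂ => e₁.eval σ ≤ e₂.eval σ
  | .natLt e₁ e₂ => e₁.eval σ < e₂.eval σ
  | .realLe e₁ e₂ => e₁.eval G σ ≤ e₂.eval G σ
  | .realLt e₁ e₂ => e₁.eval G σ < e₂.eval G σ

def Test.cost {M : ℕ} (n : ℕ) : Test M → ℕ
  | .natLe e₁ e₂ => e₁.cost + e₂.cost + 1
  | .natLt e₁ e₂ => e₁.cost + e₂.cost + 1
  | .realLe e₁ e₂ => e₁.cost n + e₂.cost n + 1
  | .realLt e₁ e₂ => e₁.cost n + e₂.cost n + 1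

/-- `Runs G c σ τ t`: on the game `G`, the program `c` started in the memory `σ` halts in the
memory `τ` after exactly `t` steps. -/
inductive Runs {M n : ℕ} (G : PenaltyGame M n) : Program M → Store → Store → ℕ → Prop where
  | skip (σ : Store) : Runs G .skip σ σ 1
  | setNat (x : ℕ) (e : NatExp) (σ : Store) :
      Runs G (.setNat x e) σ
        (σ.setNat x (e.eval σ)) (e.cost + 1)
  | setReal (x : ℕ) (e : RealExp M) (σ : Store) :
      Runs G (.setReal x e) σ
        (σ.setReal x (e.eval G σ)) (e.cost n + 1)
  | putNat (a : ℕ) (pos e : NatExp) (σ : Store) :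
      Runs G (.putNat a pos e) σ
        (σ.putNat a (pos.eval σ) (e.eval σ)) (pos.cost + e.cost + 1)
  | putReal (a : ℕ) (pos : NatExp) (e : RealExp M) (σ : Store) :
      Runs G (.putReal a pos e) σ
        (σ.putReal a (pos.eval σ) (e.eval G σ)) (pos.cost + e.cost n + 1)
  | seq {c d : Program M} {σ τ ρ : Store} {s t : ℕ} :
      Runs G c σ τ s → Runs G d τ ρ t → Runs G (.seq c d) σ ρ (s + t)
  | branchTrue {b : Test M} {c d : Program M} {σ τ : Store} {t : ℕ} :
      b.Holds G σ → Runs G c σ τ t → Runs G (.branch b c d) σ τ (b.cost n + t)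
  | branchFalse {b : Test M} {c d : Program M} {σ τ : Store} {t : ℕ} :
      ¬ b.Holds G σ → Runs G d σ τ t → Runs G (.branch b c d) σ τ (b.cost n + t)
  | loopStop {b : Test M} {c : Program M} {σ : Store} :
      ¬ b.Holds G σ → Runs G (.loop b c) σ σ (b.cost n)
  | loopStep {b : Test M} {c : Program M} {σ τ ρ : Store} {s t : ℕ} :
      b.Holds G σ → Runs G c σ τ s → Runs G (.loop b c) τ ρ t →
        Runs G (.loop b c) σ ρ (b.cost n + s + t)

/-- The initial memory: natural number variable `0` holds `n`, the real variables `0` and `1` hold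
`ε` and `λ`, and everything else is zero. -/
def initialStore (n : ℕ) (eps lam : ℝ) : Store where
  nat := fun x => if x = 0 then n else 0
  real := fun x => if x = 0 then eps else if x = 1 then lam else 0
  natArr := fun _ _ => 0
  realArr := fun _ _ => 0

/-- The answer "there is no exact equilibrium" is given by the value `0` of natural number
variable `0`; any other value announces a profile. -/
def Store.SaysNoEquilibrium (τ : Store) : Prop := τ.nat 0 = 0

/-- The announced profile: the strategy of player `i` is in the real array `i`. -/
def Store.outputProfile (M n : ℕ) (τ : Store) : Fin M → Fin n → ℝ :=
  fun i s => τ.realArr i s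

end PenaltyGames

namespace PenaltyGames

/-! The algorithm is an exhaustive search over profiles of empirical distributions of `k` pure
strategies, where `k` is of order `(1 + λ²)(1 + 1/ε²) log (n + 1)` for fixed `M`. The sampling
argument behind it is made deterministic: under a draw from `x`, the sum of an exponential potential
(for finitely many linear functionals) and a quadratic one (for the Euclidean distance to `x`) does
not increase on average, so some choice of the next sample does not increase it. This gives
`exists_empirical_approx`; since `p ≥ 2`, Euclidean closeness bounds the `p`-norm and hence the
change of a penalty.

Let `η = ε / (M + λ)`. Replacing the strategies of an exact equilibrium one player at a time changes
every payoff, and every payoff after a pure deviation, by at most `M * η`, and every penalty by at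
most `λ * η`, where `M * η + λ * η = ε`. The resulting sparse profile passes the test that no sparse
deviation gains more than `2ε` (`exists_passesTest`). Conversely, an arbitrary deviation from a
profile is `ε`-close in utility to a sparse one, so every profile that passes the test is a
`3ε`-equilibrium (`PassesTest.isApproxEquilibrium`). Thus a failed search certifies that no exact
equilibrium exists.

Sparse profiles are the digit strings of length `M * k` in base `n`, and sparse deviations those of
length `k`. Three nested base-`n` counters, for profiles, deviations and pure profiles, carry out
the search. Running times are recorded as exponents of `n + 1`, so that nested loops add exponents;
`Spec.main` ends with an exponent linear in `k`, and `sampleCount_le` turns it into the stated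
bound. -/

/-! ### Sparse approximation of mixed strategies -/

/-- The empirical distribution of the first `k` terms of a sequence. -/
noncomputable def empirical (k n : ℕ) (d : ℕ → ℕ) (s : Fin n) : ℝ :=
  ∑ j ∈ Finset.range k, if d j = s then 1 / (k : ℝ) else 0

theorem empirical_mem_stdSimplex {k n : ℕ} (hk : 0 < k) {d : ℕ → ℕ} (hd : ∀ j < k, d j < n) :
    empirical k n d ∈ stdSimplex ℝ (Fin n) := by
  refine ⟨fun s => Finset.sum_nonneg fun j _ => ?_, ?_⟩
  · split_ifs <;> positivity
  · unfold empirical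
    rw [Finset.sum_comm]
    have h : ∀ j ∈ Finset.range k, ∑ s : Fin n, (if d j = s then 1 / (k : ℝ) else 0) = 1 / k := by
      intro j hj
      have hj' := hd j (Finset.mem_range.1 hj)
      rw [Finset.sum_eq_single (⟨d j, hj'⟩ : Fin n)]
      · simp
      · intro b _ hb
        rw [if_neg]
        rintro h
        exact hb (Fin.ext h.symm)
      · simp
    rw [Finset.sum_congr rfl h]
    have : (k : ℝ) ≠ 0 := by positivity
    simp [this]

theorem sum_mul_empirical {k n : ℕ} (a : ℕ → Fin n) (r : Fin n → ℝ) :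
    ∑ s, r s * empirical k n (fun j => a j) s = (∑ j ∈ Finset.range k, r (a j)) / k := by
  unfold empirical
  simp_rw [Finset.mul_sum]
  rw [Finset.sum_comm, Finset.sum_div]
  refine Finset.sum_congr rfl fun j _ => ?_
  simp [Fin.val_inj, div_eq_mul_inv]

/-- The probabilistic method: if all values exceeded `b`, so would their average. -/
theorem exists_le_of_weighted_sum_le {n : ℕ} {x : Fin n → ℝ} (hx : x ∈ stdSimplex ℝ (Fin n))
    {F : Fin n → ℝ} {b : ℝ} (h : ∑ s, x s * F s ≤ b) : ∃ s, F s ≤ b := by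
  by_contra! hc
  have h1 : ∑ s, x s * (F s - b) ≤ 0 := by
    simp_rw [mul_sub, Finset.sum_sub_distrib, ← Finset.sum_mul, hx.2]
    linarith
  have h2 : ∀ s, 0 ≤ x s * (F s - b) := fun s => mul_nonneg (hx.1 s) (by linarith [hc s])
  have h3 := (Finset.sum_eq_zero_iff_of_nonneg (fun s _ => h2 s)).1
    (le_antisymm h1 (Finset.sum_nonneg fun s _ => h2 s))
  have h4 : ∀ s, x s = 0 := fun s => by
    rcases mul_eq_zero.1 (h3 s (Finset.mem_univ s)) with h | h
    · exact h
    · linarith [hc s]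
  have := hx.2
  simp [h4] at this

/-- Hoeffding's argument. By convexity the exponential lies below its chord on `[-1, 1]`; the
mean-zero condition removes the `sinh` term, and `cosh θ ≤ exp (θ² / 2)`. -/
theorem weighted_sum_exp_le {n : ℕ} {x : Fin n → ℝ} (hx : x ∈ stdSimplex ℝ (Fin n))
    {d : Fin n → ℝ} (hd : ∀ s, |d s| ≤ 1) (hm : ∑ s, x s * d s = 0) (θ : ℝ) :
    ∑ s, x s * Real.exp (d s * θ) ≤ Real.exp (θ ^ 2 / 2) := by
  calc ∑ s, x s * Real.exp (d s * θ)
      ≤ ∑ s, x s * (Real.cosh θ + d s * Real.sinh θ) :=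
        Finset.sum_le_sum fun s _ => mul_le_mul_of_nonneg_left
          (Real.exp_mul_le_cosh_add_mul_sinh (hd s) θ) (hx.1 s)
    _ = Real.cosh θ := by
        simp_rw [mul_add, Finset.sum_add_distrib, ← mul_assoc, ← Finset.sum_mul, hx.2, hm]
        ring
    _ ≤ _ := Real.cosh_le_exp_half_sq θ

/-- The increment `e_t - x` has mean zero, so the cross term vanishes on average, and its variance
is `1 - ∑ x_s² ≤ 1`. -/
theorem weighted_sum_sq_le {n : ℕ} {x : Fin n → ℝ} (hx : x ∈ stdSimplex ℝ (Fin n))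
    (v : Fin n → ℝ) :
    ∑ t, x t * ∑ s, (v s + ((if t = s then 1 else 0) - x s)) ^ 2 ≤ ∑ s, v s ^ 2 + 1 := by
  simp_rw [Finset.mul_sum]
  rw [Finset.sum_comm]
  have h : ∀ s, ∑ t, x t * (v s + ((if t = s then 1 else 0) - x s)) ^ 2
      ≤ v s ^ 2 + x s := by
    intro s
    have h1 : ∀ t, x t * (v s + ((if t = s then 1 else 0) - x s)) ^ 2 =
        x t * (v s - x s) ^ 2 + x t * ((if t = s then 1 else 0) * (2 * (v s - x s) + 1)) := by
      intro t
      split_ifs <;> ring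
    simp_rw [h1, Finset.sum_add_distrib, ← Finset.sum_mul, hx.2]
    simp only [ite_mul, one_mul, zero_mul, mul_ite, mul_zero, Finset.sum_ite_eq',
      Finset.mem_univ, if_true]
    nlinarith [sq_nonneg (x s)]
  calc _ ≤ ∑ s, (v s ^ 2 + x s) := Finset.sum_le_sum fun s _ => h s
    _ = _ := by rw [Finset.sum_add_distrib, hx.2]

/-- Greedy choice of samples, controlled by an exponential potential and a quadratic one. -/
theorem exists_greedy_sequence {n : ℕ} {x : Fin n → ℝ} (hx : x ∈ stdSimplex ℝ (Fin n))
    {κ : Type*} [Fintype κ] (d : κ → Fin n → ℝ) (hd : ∀ r s, |d r s| ≤ 1)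
    (hm : ∀ r, ∑ s, x s * d r s = 0) (θ : ℝ) {c : ℝ} (hc : 0 ≤ c) (k : ℕ) :
    ∃ a : ℕ → Fin n,
      (∑ r, Real.exp ((∑ j ∈ Finset.range k, d r (a j)) * θ)) * Real.exp (-(k * (θ ^ 2 / 2))) +
        c * (∑ s, (∑ j ∈ Finset.range k, ((if a j = s then 1 else 0) - x s)) ^ 2 - k) ≤
      Fintype.card κ := by
  induction k with
  | zero =>
    obtain ⟨s, -⟩ := exists_le_of_weighted_sum_le hx (F := fun _ => 0) (b := 0) (by simp)
    exact ⟨fun _ => s, by simp⟩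
  | succ k ih =>
    obtain ⟨a, ha⟩ := ih
    set S : κ → ℝ := fun r => ∑ j ∈ Finset.range k, d r (a j) with hS
    set v : Fin n → ℝ := fun s => ∑ j ∈ Finset.range k, ((if a j = s then 1 else 0) - x s) with hv
    set w := Real.exp (-(k * (θ ^ 2 / 2))) with hw
    have hw' : Real.exp (-((k + 1 : ℕ) * (θ ^ 2 / 2))) = w * Real.exp (-(θ ^ 2 / 2)) := by
      rw [hw, ← Real.exp_add]
      congr 1
      push_cast
      ring
    -- The potential after one more sample `t`, averaged over `x`, is at most the potential before.
    -- The factor `exp (-(θ² / 2))` absorbs the Hoeffding bound, and the extra `-1` in the quadratic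
    -- part absorbs the variance.
    have key : ∑ t, x t * ((∑ r, Real.exp ((S r + d r t) * θ)) * (w * Real.exp (-(θ ^ 2 / 2))) +
        c * (∑ s, (v s + ((if t = s then 1 else 0) - x s)) ^ 2 - (k + 1))) ≤ Fintype.card κ := by
      have e1 : ∀ t, x t * ((∑ r, Real.exp ((S r + d r t) * θ)) * (w * Real.exp (-(θ ^ 2 / 2))) +
          c * (∑ s, (v s + ((if t = s then 1 else 0) - x s)) ^ 2 - (k + 1))) =
          (∑ r, Real.exp (S r * θ) * (x t * Real.exp (d r t * θ))) *
            (w * Real.exp (-(θ ^ 2 / 2))) +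
          c * (x t * ∑ s, (v s + ((if t = s then 1 else 0) - x s)) ^ 2 - x t * (k + 1)) := by
        intro t
        have : ∑ r, Real.exp (S r * θ) * (x t * Real.exp (d r t * θ)) =
            x t * ∑ r, Real.exp ((S r + d r t) * θ) := by
          rw [Finset.mul_sum]
          refine Finset.sum_congr rfl fun r _ => ?_
          rw [add_mul, Real.exp_add]
          ring
        rw [this]
        ring
      simp_rw [e1, Finset.sum_add_distrib, ← Finset.sum_mul, ← Finset.mul_sum,
        Finset.sum_sub_distrib, ← Finset.sum_mul, hx.2]
      have h1 : ∑ t, ∑ r, Real.exp (S r * θ) * (x t * Real.exp (d r t * θ)) ≤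
          (∑ r, Real.exp (S r * θ)) * Real.exp (θ ^ 2 / 2) := by
        rw [Finset.sum_comm, Finset.sum_mul]
        refine Finset.sum_le_sum fun r _ => ?_
        rw [← Finset.mul_sum]
        exact mul_le_mul_of_nonneg_left (weighted_sum_exp_le hx (hd r) (hm r) θ)
          (Real.exp_nonneg _)
      have h2 := mul_le_mul_of_nonneg_right h1
        (show 0 ≤ w * Real.exp (-(θ ^ 2 / 2)) by positivity)
      have h3 : (∑ r, Real.exp (S r * θ)) * Real.exp (θ ^ 2 / 2) *
          (w * Real.exp (-(θ ^ 2 / 2))) = (∑ r, Real.exp (S r * θ)) * w := by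
        have : Real.exp (θ ^ 2 / 2) * Real.exp (-(θ ^ 2 / 2)) = 1 := by
          rw [← Real.exp_add]; simp
        linear_combination (∑ r, Real.exp (S r * θ)) * w * this
      have h4 := mul_le_mul_of_nonneg_left (weighted_sum_sq_le hx v) hc
      rw [h3] at h2
      linarith
    obtain ⟨t, ht⟩ := exists_le_of_weighted_sum_le hx key
    refine ⟨fun j => if j < k then a j else t, ?_⟩
    have e2 : ∀ f : Fin n → ℝ, ∑ j ∈ Finset.range (k + 1), f (if j < k then a j else t) =
        ∑ j ∈ Finset.range k, f (a j) + f t := by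
      intro f
      rw [Finset.sum_range_succ]
      congr 1
      · exact Finset.sum_congr rfl fun j hj => by rw [if_pos (Finset.mem_range.1 hj)]
      · simp
    rw [hw']
    simp_rw [fun r => e2 (d r), fun s => e2 (fun u => (if u = s then (1 : ℝ) else 0) - x s)]
    push_cast
    exact ht

/-- Taking `θ = η` and `c = card κ / k` makes both parts of the potential comparable: each
exponential is at most `2 * card κ * exp (k * η² / 2)` and the squared deviation at most `2 * k`.
Logarithms and division by `k` or `k²` then give the two bounds. -/
theorem exists_empirical_upper {n : ℕ} {x : Fin n → ℝ} (hx : x ∈ stdSimplex ℝ (Fin n))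
    {κ : Type*} [Fintype κ] [Nonempty κ] (r : κ → Fin n → ℝ) (hr : ∀ i s, r i s ∈ Set.Icc (0 : ℝ) 1)
    {η : ℝ} (hη : 0 < η) {k : ℕ} (hk1 : 2 * Real.log (2 * Fintype.card κ) ≤ k * η ^ 2)
    (hk2 : 2 ≤ k * η ^ 2) :
    ∃ a : ℕ → Fin n,
      (∀ i, ∑ s, r i s * empirical k n (fun j => a j) s ≤ ∑ s, r i s * x s + η) ∧
      ∑ s, (empirical k n (fun j => a j) s - x s) ^ 2 ≤ η ^ 2 := by
  have hkpos : (0 : ℝ) < k := by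
    by_contra! h
    nlinarith [sq_nonneg η]
  have hcard : (0 : ℝ) < Fintype.card κ := by exact_mod_cast Fintype.card_pos
  have hmean : ∀ i, ∑ s, x s * r i s ∈ Set.Icc (0 : ℝ) 1 := fun i =>
    ⟨Finset.sum_nonneg fun s _ => mul_nonneg (hx.1 s) (hr i s).1, by
      calc ∑ s, x s * r i s ≤ ∑ s, x s * 1 :=
            Finset.sum_le_sum fun s _ => mul_le_mul_of_nonneg_left (hr i s).2 (hx.1 s)
        _ = 1 := by simp [hx.2]⟩
  obtain ⟨a, ha⟩ := exists_greedy_sequence hx (fun i s => r i s - ∑ t, x t * r i t)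
    (fun i s => abs_le.2 ⟨by linarith [(hr i s).1, (hmean i).2], by
      linarith [(hr i s).2, (hmean i).1]⟩)
    (fun i => by simp_rw [mul_sub, Finset.sum_sub_distrib, ← Finset.sum_mul, hx.2]; ring)
    η (c := Fintype.card κ / k) (by positivity) k
  have hV : (0 : ℝ) ≤ ∑ s, (∑ j ∈ Finset.range k, ((if a j = s then 1 else 0) - x s)) ^ 2 :=
    Finset.sum_nonneg fun s _ => sq_nonneg _
  set V := ∑ s, (∑ j ∈ Finset.range k, ((if a j = s then (1 : ℝ) else 0) - x s)) ^ 2 with hVdef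
  have hck : (Fintype.card κ : ℝ) / k * (V - k) = Fintype.card κ / k * V - Fintype.card κ := by
    field_simp
  rw [hck] at ha
  refine ⟨a, fun i => ?_, ?_⟩
  · set S := ∑ j ∈ Finset.range k, (r i (a j) - ∑ t, x t * r i t) with hSdef
    have h1 : Real.exp (S * η) * Real.exp (-(k * (η ^ 2 / 2))) ≤ 2 * Fintype.card κ := by
      have : Real.exp (S * η) ≤
          ∑ i, Real.exp ((∑ j ∈ Finset.range k, (r i (a j) - ∑ t, x t * r i t)) * η) :=
        Finset.single_le_sum
          (f := fun i => Real.exp ((∑ j ∈ Finset.range k, (r i (a j) - ∑ t, x t * r i t)) * η))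
          (fun i _ => Real.exp_nonneg _) (Finset.mem_univ i)
      have h2 := mul_le_mul_of_nonneg_right this (Real.exp_nonneg (-(k * (η ^ 2 / 2))))
      have h3 : 0 ≤ (Fintype.card κ : ℝ) / k * V := by positivity
      linarith
    rw [← Real.exp_add, ← Real.le_log_iff_exp_le (by positivity)] at h1
    have h4 : S ≤ k * η := by
      by_contra! h
      nlinarith
    rw [sum_mul_empirical]
    have h5 : S = ∑ j ∈ Finset.range k, r i (a j) - k * ∑ t, x t * r i t := by
      rw [hSdef, Finset.sum_sub_distrib]; simp
    have h6 : ∑ s, r i s * x s = ∑ t, x t * r i t :=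
      Finset.sum_congr rfl fun s _ => mul_comm _ _
    rw [h6, div_le_iff₀ hkpos]
    linarith
  · have h1 : ∑ s, (empirical k n (fun j => a j) s - x s) ^ 2 = V / k ^ 2 := by
      rw [hVdef, Finset.sum_div]
      refine Finset.sum_congr rfl fun s _ => ?_
      rw [← div_pow]
      congr 1
      unfold empirical
      rw [Finset.sum_sub_distrib, sub_div, Finset.sum_div]
      congr 1
      · refine Finset.sum_congr rfl fun j _ => ?_
        simp only [Fin.val_inj]
        split_ifs <;> simp
      · simp; field_simp
    have h2 : V ≤ 2 * k := by
      have h3 : (0 : ℝ) ≤ (∑ i, Real.exp ((∑ j ∈ Finset.range k,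
        (r i (a j) - ∑ t, x t * r i t)) * η)) * Real.exp (-(k * (η ^ 2 / 2))) := by positivity
      have h4 : (Fintype.card κ : ℝ) * (V / k) ≤ Fintype.card κ * 2 := by
        have : (Fintype.card κ : ℝ) / k * V = Fintype.card κ * (V / k) := by ring
        linarith
      have h5 := le_of_mul_le_mul_left h4 hcard
      rwa [div_le_iff₀ hkpos] at h5
    rw [h1, div_le_iff₀ (by positivity)]
    nlinarith

/-- Every mixed strategy is close to an empirical distribution of few samples, with respect to
finitely many linear functionals and in the Euclidean norm. -/
theorem exists_empirical_approx {n : ℕ} {x : Fin n → ℝ} (hx : x ∈ stdSimplex ℝ (Fin n))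
    {ι : Type*} [Fintype ι] [Nonempty ι] (r : ι → Fin n → ℝ)
    (hr : ∀ i s, r i s ∈ Set.Icc (0 : ℝ) 1)
    {η : ℝ} (hη : 0 < η) {k : ℕ} (hk : 2 * Real.log (4 * Fintype.card ι) ≤ k * η ^ 2) :
    ∃ a : ℕ → Fin n,
      (∀ i, |∑ s, r i s * empirical k n (fun j => a j) s - ∑ s, r i s * x s| ≤ η) ∧
      ∑ s, (empirical k n (fun j => a j) s - x s) ^ 2 ≤ η ^ 2 := by
  have hcard : (1 : ℝ) ≤ Fintype.card ι := by exact_mod_cast Fintype.card_pos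
  have hlog : 1 ≤ Real.log (4 * Fintype.card ι) := by
    rw [Real.le_log_iff_exp_le (by positivity)]
    linarith [Real.exp_one_lt_d9]
  have hkpos : 0 < k := by
    rcases Nat.eq_zero_or_pos k with h | h
    · subst h; norm_num at hk; linarith
    · exact h
  -- Adding the complements `1 - r` to the family turns upper bounds into two-sided ones; the
  -- doubling of the family explains the `4` in `hk`.
  obtain ⟨a, ha, ha'⟩ := exists_empirical_upper hx (κ := ι ⊕ ι)
    (Sum.elim r fun i s => 1 - r i s)
    (by
      rintro (i | i) s
      · exact hr i s
      · exact ⟨by simpa using (hr i s).2, by simpa using (hr i s).1⟩) hη (k := k)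
    (by
      simp only [Fintype.card_sum, Nat.cast_add]
      convert hk using 3
      ring) (by linarith)
  refine ⟨a, fun i => ?_, ha'⟩
  have h1 := ha (Sum.inl i)
  have h2 := ha (Sum.inr i)
  have h3 := (empirical_mem_stdSimplex (n := n) hkpos (d := fun j => a j) (fun j _ => (a j).2)).2
  simp only [Sum.elim_inl, Sum.elim_inr, sub_mul, one_mul, Finset.sum_sub_distrib, h3, hx.2]
    at h1 h2
  rw [abs_le]
  constructor <;> linarith

/-- The `p`-norm is at most the Euclidean norm. -/
theorem lpNorm_le_of_sum_sq_le {d : ℕ} {p : ℝ} (hp : 2 ≤ p) {v : Fin d → ℝ} {η : ℝ} (hη : 0 < η)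
    (h : ∑ i, v i ^ 2 ≤ η ^ 2) : lpNorm p v ≤ η := by
  have hle : ∀ i, |v i| ≤ η := fun i => abs_le_of_sq_le_sq
    ((Finset.single_le_sum (f := fun i => v i ^ 2) (fun i _ => sq_nonneg _)
      (Finset.mem_univ i)).trans h) hη.le
  have hsum : ∑ i, |v i| ^ p ≤ η ^ p := by
    calc ∑ i, |v i| ^ p ≤ ∑ i, v i ^ 2 * η ^ (p - 2) := by
          refine Finset.sum_le_sum fun i _ => ?_
          rcases (abs_nonneg (v i)).eq_or_lt with h0 | h0
          · rw [← h0, Real.zero_rpow (by linarith)]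
            positivity
          · have : |v i| ^ p = |v i| ^ 2 * |v i| ^ (p - 2) := by
              rw [← Real.rpow_natCast, ← Real.rpow_add h0]
              norm_num
            rw [this, sq_abs]
            exact mul_le_mul_of_nonneg_left
              (Real.rpow_le_rpow h0.le (hle i) (by linarith)) (sq_nonneg _)
      _ = (∑ i, v i ^ 2) * η ^ (p - 2) := by rw [Finset.sum_mul]
      _ ≤ η ^ 2 * η ^ (p - 2) := mul_le_mul_of_nonneg_right h (by positivity)
      _ = η ^ p := by
          rw [← Real.rpow_natCast η 2, ← Real.rpow_add hη]
          norm_num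
  unfold lpNorm
  calc _ ≤ (η ^ p) ^ (1 / p) :=
        Real.rpow_le_rpow (Finset.sum_nonneg fun i _ => by positivity) hsum (by positivity)
    _ = η := by
        rw [← Real.rpow_mul hη.le, mul_one_div_cancel (by linarith), Real.rpow_one]

/-! ### Sparse profiles and the equilibrium test -/

namespace PenaltyGame

variable {M n : ℕ}

/-- Payoffs are multilinear. With the other players fixed, the payoff is a linear functional of `y`
whose coefficients are its values at the pure strategies, which is the form that the approximation
lemma handles. -/
theorem expectedPayoff_update (G : PenaltyGame M n) (i j : Fin M) (X : Fin M → Fin n → ℝ)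
    (y : Fin n → ℝ) :
    G.expectedPayoff i (Function.update X j y) =
      ∑ t, G.expectedPayoff i (Function.update X j (Pi.single t 1)) * y t := by
  unfold expectedPayoff
  simp_rw [Finset.sum_mul]
  rw [Finset.sum_comm]
  refine Finset.sum_congr rfl fun a _ => ?_
  have h : ∀ y : Fin n → ℝ, ∏ l, Function.update X j y l (a l) =
      y (a j) * ∏ l ∈ Finset.univ.erase j, X l (a l) := by
    intro y
    rw [← Finset.mul_prod_erase _ _ (Finset.mem_univ j)]
    congr 1
    · simp
    · exact Finset.prod_congr rfl fun l hl => by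
        rw [Function.update_of_ne (Finset.ne_of_mem_erase hl)]
  simp_rw [h, Pi.single_apply]
  simp
  ring

theorem expectedPayoff_mem_Icc {G : PenaltyGame M n}
    (hG : ∀ i a, G.payoff i a ∈ Set.Icc (0 : ℝ) 1) (i : Fin M) {X : Fin M → Fin n → ℝ}
    (hX : IsProfile X) : G.expectedPayoff i X ∈ Set.Icc (0 : ℝ) 1 := by
  have h0 : ∀ a : Fin M → Fin n, 0 ≤ ∏ j, X j (a j) := fun a =>
    Finset.prod_nonneg fun j _ => (hX j).1 _
  refine ⟨Finset.sum_nonneg fun a _ => mul_nonneg (h0 a) (hG i a).1, ?_⟩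
  calc G.expectedPayoff i X ≤ ∑ a : Fin M → Fin n, ∏ j, X j (a j) :=
        Finset.sum_le_sum fun a _ => mul_le_of_le_one_right (h0 a) (hG i a).2
    _ = ∏ j, ∑ s, X j s := by
        rw [Finset.prod_univ_sum, Fintype.piFinset_univ]
    _ = 1 := Finset.prod_eq_one fun j _ => (hX j).2

theorem IsProfile.update {X : Fin M → Fin n → ℝ} (hX : IsProfile X) (j : Fin M) {y : Fin n → ℝ}
    (hy : y ∈ stdSimplex ℝ (Fin n)) : IsProfile (Function.update X j y) := by
  intro i
  rcases eq_or_ne i j with rfl | h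
  · simpa using hy
  · simpa [Function.update_of_ne h] using hX i

/-- Replacing the strategies of some players by empirical distributions, one player at a time. -/
theorem exists_empirical_profile_on {G : PenaltyGame M n}
    (hG : ∀ i a, G.payoff i a ∈ Set.Icc (0 : ℝ) 1) {x : Fin M → Fin n → ℝ} (hx : IsProfile x)
    {η : ℝ} (hη : 0 < η) {k : ℕ} (hk : 2 * Real.log (4 * (M * (n + 1))) ≤ k * η ^ 2)
    (hkpos : 0 < k) (P : Finset (Fin M)) :
    ∃ X : Fin M → Fin n → ℝ, IsProfile X ∧
      (∀ j ∈ P, (∃ a : ℕ → Fin n, X j = empirical k n (fun t => a t)) ∧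
        ∑ s, (X j s - x j s) ^ 2 ≤ η ^ 2) ∧
      (∀ j ∉ P, X j = x j) ∧
      (∀ i, |G.expectedPayoff i X - G.expectedPayoff i x| ≤ P.card * η) ∧
      (∀ i s, |G.expectedPayoff i (Function.update X i (Pi.single s 1)) -
        G.expectedPayoff i (Function.update x i (Pi.single s 1))| ≤ P.card * η) := by
  induction P using Finset.induction_on with
  | empty => exact ⟨x, hx, by simp, by simp, by simp, by simp⟩
  | insert j P hj ih =>
    obtain ⟨X, hX, hXP, hXn, h1, h2⟩ := ih
    have hsingle : ∀ s : Fin n, Pi.single s (1 : ℝ) ∈ stdSimplex ℝ (Fin n) :=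
      fun s => single_mem_stdSimplex ℝ s
    have : Nonempty (Fin M × Option (Fin n)) := ⟨(j, none)⟩
    -- The functionals to be preserved when `j` is replaced: for each player, the payoff itself
    -- (`none`) and the payoff after each pure deviation (`some s`), `M * (n + 1)` in all.
    obtain ⟨a, ha, ha'⟩ := exists_empirical_approx (hX j) (ι := Fin M × Option (Fin n))
      (fun q t => match q.2 with
        | none => G.expectedPayoff q.1 (Function.update X j (Pi.single t 1))
        | some s => G.expectedPayoff q.1
            (Function.update (Function.update X j (Pi.single t 1)) q.1 (Pi.single s 1)))
      (by
        rintro ⟨i, _ | s⟩ t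
        · exact expectedPayoff_mem_Icc hG i (hX.update j (hsingle t))
        · exact expectedPayoff_mem_Icc hG i ((hX.update j (hsingle t)).update i (hsingle s)))
      hη (k := k) (by simpa using hk)
    set y := empirical k n (fun t => a t) with hy
    have hyΔ : y ∈ stdSimplex ℝ (Fin n) := empirical_mem_stdSimplex hkpos fun t _ => (a t).2
    refine ⟨Function.update X j y, hX.update j hyΔ, ?_, ?_, ?_, ?_⟩
    · intro i hi
      rcases eq_or_ne i j with rfl | h
      · rw [Function.update_self]
        exact ⟨⟨a, rfl⟩, by rw [← hXn i hj]; exact ha'⟩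
      · rw [Function.update_of_ne h]
        exact hXP i (Finset.mem_of_mem_insert_of_ne hi h)
    · intro i hi
      rw [Finset.mem_insert, not_or] at hi
      rw [Function.update_of_ne hi.1]
      exact hXn i hi.2
    · intro i
      have e1 := ha (i, none)
      simp only at e1
      rw [← expectedPayoff_update, ← expectedPayoff_update, Function.update_eq_self] at e1
      rw [Finset.card_insert_of_notMem hj]
      push_cast
      have := abs_sub_le (G.expectedPayoff i (Function.update X j y)) (G.expectedPayoff i X)
        (G.expectedPayoff i x)
      linarith [h1 i]
    · intro i s
      rw [Finset.card_insert_of_notMem hj]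
      push_cast
      -- A deviation of `j` overwrites the strategy just replaced, so it adds no error; for the
      -- other players the functional `some s` applies.
      rcases eq_or_ne i j with rfl | h
      · rw [Function.update_idem]
        linarith [h2 i s]
      · have e1 := ha (i, some s)
        simp only [Function.update_comm h.symm] at e1
        rw [← expectedPayoff_update, ← expectedPayoff_update] at e1
        have e2 : Function.update (Function.update X i (Pi.single s 1)) j (X j) =
            Function.update X i (Pi.single s 1) := by
          rw [Function.update_comm h, Function.update_eq_self]
        rw [e2, Function.update_comm h] at e1
        have := abs_sub_le
          (G.expectedPayoff i (Function.update (Function.update X j y) i (Pi.single s 1)))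
          (G.expectedPayoff i (Function.update X i (Pi.single s 1)))
          (G.expectedPayoff i (Function.update x i (Pi.single s 1)))
        linarith [h2 i s]

/-- The profiles that pass the test of the search: no empirical distribution of `k` pure
strategies gains more than `2ε`. -/
def PassesTest (G : PenaltyGame M n) (eps : ℝ) (k : ℕ) (X : Fin M → Fin n → ℝ) : Prop :=
  ∀ i, ∀ a : ℕ → Fin n,
    G.utility i (Function.update X i (empirical k n fun t => a t)) ≤ G.utility i X + 2 * eps

/-- Compare three utilities: deviating from `X`, deviating from `x`, staying at `x`. The deviation
costs `M * η` in passing from `X` to `x`, since its own penalty is the same; returning from `x` to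
`X` costs `M * η + lam * η`. The total is at most `2 * eps`. -/
theorem exists_passesTest {G : PenaltyGame M n} (hM : 0 < M)
    (hG : ∀ i a, G.payoff i a ∈ Set.Icc (0 : ℝ) 1) {p lam eps : ℝ} (hp : 2 ≤ p) (hlam : 0 ≤ lam)
    (heps : 0 < eps) (hf : ∀ i, IsLpLipschitzOn lam p (G.penalty i) (stdSimplex ℝ (Fin n)))
    {k : ℕ} (hk : 2 * Real.log (4 * (M * (n + 1))) ≤ k * (eps / (M + lam)) ^ 2) (hkpos : 0 < k)
    {x : Fin M → Fin n → ℝ} (hx : G.IsEquilibrium x) :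
    ∃ a : Fin M → ℕ → Fin n, G.PassesTest eps k fun i => empirical k n fun t => a i t := by
  have hMR : (0 : ℝ) < M := by exact_mod_cast hM
  set η := eps / (M + lam) with hη
  have hηpos : 0 < η := by positivity
  have hηeq : M * η + lam * η = eps := by rw [hη]; field_simp
  obtain ⟨X, hX, hXP, -, h1, h2⟩ :=
    exists_empirical_profile_on hG hx.1 hηpos hk hkpos Finset.univ
  choose a ha using fun j => (hXP j (Finset.mem_univ j)).1
  refine ⟨a, ?_⟩
  have : (fun i => empirical k n fun t => a i t) = X := by
    funext i; exact (ha i).symm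
  rw [this]
  intro i b
  set z := empirical k n fun t => (b t : ℕ)
  have hz : z ∈ stdSimplex ℝ (Fin n) := empirical_mem_stdSimplex hkpos fun t _ => (b t).2
  have e1 := hx.2 i z hz
  have e2 := hf i _ (hX i) _ (hx.1 i)
  have e3 : lpNorm p (X i - x i) ≤ η :=
    lpNorm_le_of_sum_sq_le hp hηpos (by simpa using (hXP i (Finset.mem_univ i)).2)
  have e4 : |G.penalty i (X i) - G.penalty i (x i)| ≤ lam * η :=
    e2.trans (mul_le_mul_of_nonneg_left e3 hlam)
  -- By linearity in the deviation, the uniform bound for pure deviations averages to one for `z`.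
  have e5 : G.expectedPayoff i (Function.update X i z) ≤
      G.expectedPayoff i (Function.update x i z) + M * η := by
    rw [expectedPayoff_update, expectedPayoff_update G i i x]
    calc _ ≤ ∑ t, (G.expectedPayoff i (Function.update x i (Pi.single t 1)) + M * η) * z t := by
          refine Finset.sum_le_sum fun t _ => mul_le_mul_of_nonneg_right ?_ (hz.1 t)
          have := (abs_le.1 (h2 i t)).2
          simp only [Finset.card_univ, Fintype.card_fin] at this
          linarith
      _ = _ := by
          simp_rw [add_mul, Finset.sum_add_distrib, ← Finset.mul_sum, hz.2]
          ring
  have e6 := (abs_le.1 (h1 i)).1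
  simp only [Finset.card_univ, Fintype.card_fin] at e6
  have e7 := (abs_le.1 e4).2
  have e8 : 0 ≤ lam * η := by positivity
  unfold utility at *
  simp only [Function.update_self] at *
  linarith

/-- Here `X` stays fixed and only the deviation `z` is made sparse, so a single functional suffices.
The utility changes by at most `η + lam * η ≤ eps`, which is added to the `2 * eps` of the test. -/
theorem PassesTest.isApproxEquilibrium {G : PenaltyGame M n} (hM : 0 < M) (hn : 0 < n)
    (hG : ∀ i a, G.payoff i a ∈ Set.Icc (0 : ℝ) 1) {p lam eps : ℝ} (hp : 2 ≤ p) (hlam : 0 ≤ lam)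
    (heps : 0 < eps) (hf : ∀ i, IsLpLipschitzOn lam p (G.penalty i) (stdSimplex ℝ (Fin n)))
    {k : ℕ} (hk : 2 * Real.log (4 * (M * (n + 1))) ≤ k * (eps / (M + lam)) ^ 2) (hkpos : 0 < k)
    {X : Fin M → Fin n → ℝ} (hX : IsProfile X) (hpass : G.PassesTest eps k X) :
    G.IsApproxEquilibrium (3 * eps) X := by
  have hMR : (1 : ℝ) ≤ M := by exact_mod_cast hM
  set η := eps / (M + lam) with hη
  have hηpos : 0 < η := by positivity
  have hηeq : M * η + lam * η = eps := by rw [hη]; field_simp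
  refine ⟨hX, fun i z hz => ?_⟩
  obtain ⟨a, ha, ha'⟩ := exists_empirical_approx hz (ι := Unit)
    (fun _ t => G.expectedPayoff i (Function.update X i (Pi.single t 1)))
    (fun _ t => expectedPayoff_mem_Icc hG i (hX.update i (single_mem_stdSimplex ℝ t)))
    hηpos (k := k) (by
      refine le_trans ?_ hk
      have : (0 : ℝ) < n := by exact_mod_cast hn
      have h1 : (1 : ℝ) ≤ M * (n + 1) := by nlinarith
      have := Real.log_le_log (show (0 : ℝ) < 4 * (Fintype.card Unit) by simp)
        (show (4 * (Fintype.card Unit) : ℝ) ≤ 4 * (M * (n + 1)) by simp; linarith)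
      linarith)
  have h1 := ha ()
  have h2 := hpass i a
  set y := empirical k n fun t => (a t : ℕ)
  have hy : y ∈ stdSimplex ℝ (Fin n) := empirical_mem_stdSimplex hkpos fun t _ => (a t).2
  rw [← expectedPayoff_update, ← expectedPayoff_update] at h1
  have e2 := hf i _ hy _ hz
  have e3 : lpNorm p (y - z) ≤ η := lpNorm_le_of_sum_sq_le hp hηpos (by simpa using ha')
  have e4 : |G.penalty i y - G.penalty i z| ≤ lam * η :=
    e2.trans (mul_le_mul_of_nonneg_left e3 hlam)
  have e5 := (abs_le.1 h1).1
  have e6 := (abs_le.1 e4).2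
  have e7 : η ≤ M * η := le_mul_of_one_le_left hηpos.le hMR
  unfold utility at *
  simp only [Function.update_self] at *
  linarith

end PenaltyGame
/-! ### Reasoning about programs -/

variable {M n : ℕ} {G : PenaltyGame M n}

/-- The natural number variable `x` is assigned in the program. -/
def Program.WritesNat : Program M → ℕ → Prop
  | .setNat y _, x => x = y
  | .seq c d, x => c.WritesNat x ∨ d.WritesNat x
  | .branch _ c d, x => c.WritesNat x ∨ d.WritesNat x
  | .loop _ c, x => c.WritesNat x
  | _, _ => False

/-- The real variable `x` is assigned in the program. -/
def Program.WritesReal : Program M → ℕ → Prop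
  | .setReal y _, x => x = y
  | .seq c d, x => c.WritesReal x ∨ d.WritesReal x
  | .branch _ c d, x => c.WritesReal x ∨ d.WritesReal x
  | .loop _ c, x => c.WritesReal x
  | _, _ => False

/-- The natural number array `a` is changed in the program. -/
def Program.WritesNatArr : Program M → ℕ → Prop
  | .putNat b _ _, a => a = b
  | .seq c d, a => c.WritesNatArr a ∨ d.WritesNatArr a
  | .branch _ c d, a => c.WritesNatArr a ∨ d.WritesNatArr a
  | .loop _ c, a => c.WritesNatArr a
  | _, _ => False

/-- The real array `a` is changed in the program. -/
def Program.WritesRealArr : Program M → ℕ → Prop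
  | .putReal b _ _, a => a = b
  | .seq c d, a => c.WritesRealArr a ∨ d.WritesRealArr a
  | .branch _ c d, a => c.WritesRealArr a ∨ d.WritesRealArr a
  | .loop _ c, a => c.WritesRealArr a
  | _, _ => False

/-- The two memories agree on everything that the program does not assign. -/
structure Framed (c : Program M) (σ τ : Store) : Prop where
  nat : ∀ x, ¬ c.WritesNat x → τ.nat x = σ.nat x
  real : ∀ x, ¬ c.WritesReal x → τ.real x = σ.real x
  natArr : ∀ x, ¬ c.WritesNatArr x → τ.natArr x = σ.natArr x
  realArr : ∀ x, ¬ c.WritesRealArr x → τ.realArr x = σ.realArr x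

/-- The written variables are determined syntactically, so preservation of everything else can later
be settled by unfolding the program. -/
theorem Runs.framed {c : Program M} {σ τ : Store} {t : ℕ} (h : Runs G c σ τ t) :
    Framed c σ τ := by
  induction h with
  | skip σ => exact ⟨fun _ _ => rfl, fun _ _ => rfl, fun _ _ => rfl, fun _ _ => rfl⟩
  | setNat x e σ =>
    exact ⟨fun y hy => Function.update_of_ne hy _ _, fun _ _ => rfl, fun _ _ => rfl,
      fun _ _ => rfl⟩
  | setReal x e σ =>
    exact ⟨fun _ _ => rfl, fun y hy => Function.update_of_ne hy _ _, fun _ _ => rfl,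
      fun _ _ => rfl⟩
  | putNat a pos e σ =>
    exact ⟨fun _ _ => rfl, fun _ _ => rfl, fun y hy => Function.update_of_ne hy _ _,
      fun _ _ => rfl⟩
  | putReal a pos e σ =>
    exact ⟨fun _ _ => rfl, fun _ _ => rfl, fun _ _ => rfl,
      fun y hy => Function.update_of_ne hy _ _⟩
  | seq _ _ h1 h2 =>
    exact ⟨fun y hy => (h2.nat y fun h => hy (.inr h)).trans (h1.nat y fun h => hy (.inl h)),
      fun y hy => (h2.real y fun h => hy (.inr h)).trans (h1.real y fun h => hy (.inl h)),
      fun y hy => (h2.natArr y fun h => hy (.inr h)).trans (h1.natArr y fun h => hy (.inl h)),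
      fun y hy => (h2.realArr y fun h => hy (.inr h)).trans (h1.realArr y fun h => hy (.inl h))⟩
  | branchTrue _ _ h1 =>
    exact ⟨fun y hy => h1.nat y fun h => hy (.inl h), fun y hy => h1.real y fun h => hy (.inl h),
      fun y hy => h1.natArr y fun h => hy (.inl h), fun y hy => h1.realArr y fun h => hy (.inl h)⟩
  | branchFalse _ _ h1 =>
    exact ⟨fun y hy => h1.nat y fun h => hy (.inr h), fun y hy => h1.real y fun h => hy (.inr h),
      fun y hy => h1.natArr y fun h => hy (.inr h), fun y hy => h1.realArr y fun h => hy (.inr h)⟩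
  | loopStop _ => exact ⟨fun _ _ => rfl, fun _ _ => rfl, fun _ _ => rfl, fun _ _ => rfl⟩
  | loopStep _ _ _ h1 h2 =>
    exact ⟨fun y hy => (h2.nat y hy).trans (h1.nat y hy),
      fun y hy => (h2.real y hy).trans (h1.real y hy),
      fun y hy => (h2.natArr y hy).trans (h1.natArr y hy),
      fun y hy => (h2.realArr y hy).trans (h1.realArr y hy)⟩

/-- Started in `σ`, the program halts after at most `(n + 1) ^ e` steps in a memory that
satisfies `Q`. -/
def Spec (G : PenaltyGame M n) (c : Program M) (σ : Store) (e : ℕ) (Q : Store → Prop) : Prop :=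
  ∃ τ t, Runs G c σ τ t ∧ t ≤ (n + 1) ^ e ∧ Q τ

/-- Since `n + 1 ≥ 2`, a sum of powers costs only one extra exponent. This and `le_pow_self` allow
all time bounds to be kept as exponents. -/
theorem add_le_pow (hn : 0 < n) {a b s t : ℕ} (hs : s ≤ (n + 1) ^ a) (ht : t ≤ (n + 1) ^ b) :
    s + t ≤ (n + 1) ^ (a + b + 1) := by
  have ha : 1 ≤ (n + 1) ^ a := Nat.one_le_pow _ _ (by omega)
  have hb : 1 ≤ (n + 1) ^ b := Nat.one_le_pow _ _ (by omega)
  calc s + t ≤ (n + 1) ^ a + (n + 1) ^ b := add_le_add hs ht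
    _ ≤ (n + 1) ^ a * (n + 1) ^ b * 2 := by nlinarith
    _ ≤ (n + 1) ^ a * (n + 1) ^ b * (n + 1) := Nat.mul_le_mul_left _ (by omega)
    _ = _ := by ring

theorem le_pow_self (hn : 0 < n) (a : ℕ) : a + 1 ≤ (n + 1) ^ a :=
  (Nat.lt_pow_self (by omega : 1 < n + 1) : a < (n + 1) ^ a)

theorem Spec.mono {c : Program M} {σ : Store} {e e' : ℕ} {Q Q' : Store → Prop}
    (h : Spec G c σ e Q) (he : e ≤ e') (hQ : ∀ τ, Framed c σ τ → Q τ → Q' τ) :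
    Spec G c σ e' Q' := by
  obtain ⟨τ, t, hr, ht, hq⟩ := h
  exact ⟨τ, t, hr, ht.trans (Nat.pow_le_pow_right (by omega) he), hQ τ hr.framed hq⟩

theorem Spec.skip {σ : Store} {e : ℕ} {Q : Store → Prop} (hQ : Q σ) :
    Spec G .skip σ e Q :=
  ⟨σ, 1, .skip σ, Nat.one_le_pow _ _ (by omega), hQ⟩

theorem Spec.setNat (hn : 0 < n) {x : ℕ} {v : NatExp} {σ : Store} {e : ℕ} {Q : Store → Prop}
    (he : v.cost ≤ e) (hQ : Q (σ.setNat x (v.eval σ))) : Spec G (.setNat x v) σ e Q :=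
  ⟨_, _, .setNat x v σ, (le_pow_self hn _).trans (Nat.pow_le_pow_right (by omega) he), hQ⟩

theorem Spec.putNat (hn : 0 < n) {a : ℕ} {pos v : NatExp} {σ : Store} {e : ℕ} {Q : Store → Prop}
    (he : pos.cost + v.cost ≤ e) (hQ : Q (σ.putNat a (pos.eval σ) (v.eval σ))) :
    Spec G (.putNat a pos v) σ e Q :=
  ⟨_, _, .putNat a pos v σ, (le_pow_self hn _).trans (Nat.pow_le_pow_right (by omega) he), hQ⟩

theorem Spec.setReal {x : ℕ} {v : RealExp M} {σ : Store} {e : ℕ}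
    {Q : Store → Prop} (he : v.cost n + 1 ≤ (n + 1) ^ e)
    (hQ : Q (σ.setReal x (v.eval G σ))) : Spec G (.setReal x v) σ e Q :=
  ⟨_, _, .setReal x v σ, he, hQ⟩

theorem Spec.putReal {a : ℕ} {pos : NatExp} {v : RealExp M} {σ : Store} {e : ℕ}
    {Q : Store → Prop} (he : pos.cost + v.cost n + 1 ≤ (n + 1) ^ e)
    (hQ : Q (σ.putReal a (pos.eval σ) (v.eval G σ))) : Spec G (.putReal a pos v) σ e Q :=
  ⟨_, _, .putReal a pos v σ, he, hQ⟩

theorem Spec.seq (hn : 0 < n) {c d : Program M} {σ : Store} {a b e : ℕ} {R Q : Store → Prop}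
    (hc : Spec G c σ a R) (he : a + b + 1 ≤ e)
    (hd : ∀ τ, Framed c σ τ → R τ → Spec G d τ b Q) :
    Spec G (.seq c d) σ e Q := by
  obtain ⟨τ, s, h1, hs, hR⟩ := hc
  obtain ⟨ρ, t, h2, ht, hQ⟩ := hd τ h1.framed hR
  exact ⟨ρ, s + t, .seq h1 h2,
    (add_le_pow hn hs ht).trans (Nat.pow_le_pow_right (by omega) he), hQ⟩

theorem Spec.branch (hn : 0 < n) {b : Test M} {c d : Program M} {σ : Store} {a e : ℕ}
    {Q : Store → Prop} (he : b.cost n + a + 1 ≤ e) (hc : b.Holds G σ → Spec G c σ a Q)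
    (hd : ¬ b.Holds G σ → Spec G d σ a Q) : Spec G (.branch b c d) σ e Q := by
  have hb := Nat.le_of_succ_le (le_pow_self hn (b.cost n))
  by_cases h : b.Holds G σ
  · obtain ⟨τ, t, hr, ht, hQ⟩ := hc h
    exact ⟨τ, _, .branchTrue h hr,
      (add_le_pow hn hb ht).trans (Nat.pow_le_pow_right (by omega) he), hQ⟩
  · obtain ⟨τ, t, hr, ht, hQ⟩ := hd h
    exact ⟨τ, _, .branchFalse h hr,
      (add_le_pow hn hb ht).trans (Nat.pow_le_pow_right (by omega) he), hQ⟩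

/-- A loop that makes `N` rounds, where `I m` holds after `m` rounds. -/
theorem Spec.loop (hn : 0 < n) {b : Test M} {c : Program M} {σ : Store} {N a h e : ℕ}
    (I : ℕ → Store → Prop) (hN : N + 1 ≤ (n + 1) ^ h) (he : b.cost n + a + h + 1 ≤ e)
    (h0 : I 0 σ)
    (hstep : ∀ m < N, ∀ σ, I m σ → b.Holds G σ ∧ Spec G c σ a (I (m + 1)))
    (hend : ∀ σ, I N σ → ¬ b.Holds G σ) : Spec G (.loop b c) σ e (I N) := by
  have hb := Nat.le_of_succ_le (le_pow_self hn (b.cost n))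
  -- Induction on the number `r` of remaining rounds; the factor `r + 1` includes the final failing
  -- test.
  have key : ∀ r ≤ N, ∀ σ, I (N - r) σ → ∃ τ t, Runs G (.loop b c) σ τ t ∧
      t ≤ (r + 1) * (n + 1) ^ (b.cost n + a + 1) ∧ I N τ := by
    intro r
    induction r with
    | zero =>
      intro _ σ hσ
      refine ⟨σ, _, .loopStop (hend σ hσ), ?_, hσ⟩
      rw [zero_add, one_mul]
      exact hb.trans (Nat.pow_le_pow_right (by omega) (by omega))
    | succ r ih =>
      intro hr σ hσ
      obtain ⟨hbσ, τ, s, hrun, hs, hτ⟩ := hstep _ (by omega) σ hσ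
      rw [show N - (r + 1) + 1 = N - r by omega] at hτ
      obtain ⟨ρ, t, hrun', ht, hρ⟩ := ih (by omega) τ hτ
      refine ⟨ρ, _, .loopStep hbσ hrun hrun', ?_, hρ⟩
      have := add_le_pow hn hb hs
      calc _ ≤ (n + 1) ^ (b.cost n + a + 1) + (r + 1) * (n + 1) ^ (b.cost n + a + 1) :=
            add_le_add this ht
        _ = _ := by ring
  obtain ⟨τ, t, hrun, ht, hτ⟩ := key N le_rfl σ (by simpa using h0)
  refine ⟨τ, t, hrun, ?_, hτ⟩
  calc t ≤ (N + 1) * (n + 1) ^ (b.cost n + a + 1) := ht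
    _ ≤ (n + 1) ^ h * (n + 1) ^ (b.cost n + a + 1) := Nat.mul_le_mul_right _ hN
    _ = (n + 1) ^ (b.cost n + a + h + 1) := by rw [← pow_add]; congr 1; omega
    _ ≤ _ := Nat.pow_le_pow_right (by omega) he

/-- `for x < bound do c`. -/
def Program.forLoop (x bound : ℕ) (c : Program M) : Program M :=
  .seq (.setNat x (.lit 0)) (.loop (.natLt (.var x) (.var bound))
    (.seq c (.setNat x (.add (.var x) (.lit 1)))))

/-- The invariant must not depend on the loop variable (`hI`), because that variable is reset at the
start and advanced after each round; its value is supplied separately to `hstep`. -/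
theorem Spec.forLoop (hn : 0 < n) {x bound : ℕ} {c : Program M} {σ : Store} {N a h e : ℕ}
    (I : ℕ → Store → Prop) (hxb : bound ≠ x) (hcx : ¬ c.WritesNat x) (hcb : ¬ c.WritesNat bound)
    (hb : σ.nat bound = N) (hN : N + 1 ≤ (n + 1) ^ h) (he : a + h + 10 ≤ e)
    (hI : ∀ m σ v, I m σ → I m (σ.setNat x v)) (h0 : I 0 σ)
    (hstep : ∀ m < N, ∀ σ, σ.nat x = m → I m σ → Spec G c σ a (I (m + 1))) :
    Spec G (.forLoop x bound c) σ e (I N) := by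
  refine Spec.seq hn (a := 1) (b := a + h + 8)
    (R := fun τ => τ.nat x = 0 ∧ τ.nat bound = N ∧ I 0 τ) (Spec.setNat hn le_rfl ?_) (by omega) ?_
  · exact ⟨by simp [Store.setNat, NatExp.eval], by simp [Store.setNat, hxb, hb], hI _ _ _ h0⟩
  · intro τ _ hτ
    refine (Spec.loop hn (a := a + 4) (h := h) (N := N)
      (fun m τ => τ.nat x = m ∧ τ.nat bound = N ∧ I m τ) hN
      (by simp only [Test.cost, NatExp.cost]; omega) hτ ?_ ?_).mono le_rfl fun _ _ h => h.2.2
    · intro m hm σ' ⟨h1, h2, h3⟩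
      refine ⟨by simp only [Test.Holds, NatExp.eval, h1, h2, hm], ?_⟩
      refine Spec.seq hn (b := 3) (hstep m hm σ' h1 h3) (by omega) fun ρ hf hρ => ?_
      refine Spec.setNat hn le_rfl ⟨?_, ?_, hI _ _ _ hρ⟩
      · simp [Store.setNat, NatExp.eval, hf.nat x hcx, h1]
      · simp [Store.setNat, hxb, hf.nat bound hcb, h2]
    · rintro σ' ⟨h1, h2, -⟩
      simp [Test.Holds, NatExp.eval, h1, h2]

/-- The programs `f 0`, …, `f (m - 1)`, one after the other. -/
def Program.chain (f : ℕ → Program M) : ℕ → Program M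
  | 0 => .skip
  | m + 1 => .seq (chain f m) (f m)

theorem Program.writesNat_chain {f : ℕ → Program M} {x m : ℕ} (h : ∀ i, ¬ (f i).WritesNat x) :
    ¬ (chain f m).WritesNat x := by
  induction m with
  | zero => simp [chain, WritesNat]
  | succ m ih => simp [chain, WritesNat, ih, h]

theorem Program.writesReal_chain {f : ℕ → Program M} {x m : ℕ} (h : ∀ i, ¬ (f i).WritesReal x) :
    ¬ (chain f m).WritesReal x := by
  induction m with
  | zero => simp [chain, WritesReal]
  | succ m ih => simp [chain, WritesReal, ih, h]

theorem Program.writesNatArr_chain {f : ℕ → Program M} {x m : ℕ}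
    (h : ∀ i, ¬ (f i).WritesNatArr x) : ¬ (chain f m).WritesNatArr x := by
  induction m with
  | zero => simp [chain, WritesNatArr]
  | succ m ih => simp [chain, WritesNatArr, ih, h]

theorem Spec.chain (hn : 0 < n) {f : ℕ → Program M} {σ : Store} {N a e : ℕ}
    (I : ℕ → Store → Prop) (he : N * (a + 1) ≤ e) (h0 : I 0 σ)
    (hstep : ∀ m < N, ∀ σ, I m σ → Spec G (f m) σ a (I (m + 1))) :
    Spec G (.chain f N) σ e (I N) := by
  induction N generalizing e with
  | zero => exact Spec.skip h0
  | succ N ih =>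
    exact Spec.seq hn (ih le_rfl fun m hm => hstep m (by omega)) (by rw [add_mul] at he; omega)
      fun τ _ hτ => hstep N (by omega) τ hτ

/-! ### Enumeration of all digit strings -/

/-- The natural number variable that holds the length of the digit strings at a level. -/
abbrev dimVar (l : ℕ) : ℕ := 3 * l + 5

/-- The carry of the counter at a level. -/
abbrev carryVar (l : ℕ) : ℕ := 3 * l + 6

/-- The position of the counter at a level. -/
abbrev posVar (l : ℕ) : ℕ := 3 * l + 7

/-- Treatment of one digit when the counter is increased by one. -/
def Program.incrementDigit (l : ℕ) : Program M :=
  .seq (.putNat l (.var (posVar l)) (.add (.get l (.var (posVar l))) (.var (carryVar l))))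
    (.branch (.natLe (.var 0) (.get l (.var (posVar l))))
      (.seq (.putNat l (.var (posVar l)) (.lit 0)) (.setNat (carryVar l) (.lit 1)))
      (.setNat (carryVar l) (.lit 0)))

/-- Increase the digit string in the array `l`, read in base `n`, by one. -/
def Program.increment (l : ℕ) : Program M :=
  .seq (.setNat (carryVar l) (.lit 1)) (.forLoop (posVar l) (dimVar l) (.incrementDigit l))

/-- Run `c` for all digit strings in the array `l`. -/
def Program.enumerate (l : ℕ) (c : Program M) : Program M :=
  .seq (.forLoop (posVar l) (dimVar l) (.putNat l (.var (posVar l)) (.lit 0)))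
    (.seq (.setNat (carryVar l) (.lit 0))
      (.loop (.natLt (.var (carryVar l)) (.lit 1)) (.seq c (.increment l))))

/-- The memories differ at most in the counter of level `l`. -/
structure SameExceptCounter (l : ℕ) (σ τ : Store) : Prop where
  nat : ∀ x, x ≠ carryVar l → x ≠ posVar l → τ.nat x = σ.nat x
  real : τ.real = σ.real
  natArr : ∀ a, a ≠ l → τ.natArr a = σ.natArr a
  realArr : τ.realArr = σ.realArr

theorem Framed.sameExceptCounter {l : ℕ} {σ τ : Store}
    (h : Framed (Program.increment (M := M) l) σ τ) : SameExceptCounter l σ τ := by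
  refine ⟨fun x h1 h2 => h.nat x ?_, funext fun x => h.real x ?_, fun x h1 => h.natArr x ?_,
    funext fun x => h.realArr x ?_⟩ <;>
  simp_all [Program.increment, Program.forLoop, Program.incrementDigit, Program.WritesNat,
    Program.WritesReal, Program.WritesNatArr, Program.WritesRealArr]

/-- Here `q` stands for the number formed by the digits from the current position upwards. The last
conclusion is the carry rule for its quotient, in the form that chains from one position to the
next. -/
theorem Spec.incrementDigit (hn : 0 < n) {l q c : ℕ} {σ : Store} (h0 : σ.nat 0 = n)
    (hd : σ.natArr l (σ.nat (posVar l)) = q % n) (hc : σ.nat (carryVar l) = c) (hc1 : c ≤ 1) :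
    Spec G (.incrementDigit l) σ 15 fun τ =>
      τ.nat 0 = n ∧
      τ.natArr l = Function.update (σ.natArr l) (σ.nat (posVar l)) ((q + c) % n) ∧
      τ.nat (carryVar l) ≤ 1 ∧ q / n + τ.nat (carryVar l) = (q + c) / n := by
  have hlt := Nat.mod_lt q hn
  have hdm := Nat.div_add_mod q n
  unfold Program.incrementDigit
  refine Spec.seq hn (a := 5) (b := 9)
    (R := fun τ => τ = σ.putNat l (σ.nat (posVar l)) (q % n + c))
    (Spec.putNat hn (by simp [NatExp.cost]) (by simp [NatExp.eval, hd, hc])) (by omega) ?_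
  rintro _ - rfl
  refine Spec.branch hn (a := 4) (by simp [Test.cost, NatExp.cost]) ?_ ?_
  · intro h
    simp only [Test.Holds, NatExp.eval, Store.putNat, h0, Function.update_self] at h
    -- As `c ≤ 1`, an overflowing digit equals `n` exactly, so it becomes `0`.
    have hq : q + c = n * (q / n + 1) := by rw [mul_add]; omega
    refine Spec.seq hn (a := 2) (b := 1) (R := fun τ => τ = σ.putNat l (σ.nat (posVar l)) 0)
      (Spec.putNat hn (by simp [NatExp.cost]) (by simp [NatExp.eval, Store.putNat])) (by omega) ?_
    rintro _ - rfl
    refine Spec.setNat hn (by simp [NatExp.cost]) ⟨?_, ?_, ?_, ?_⟩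
    · simp [Store.setNat, Store.putNat, h0]
    · simp [Store.setNat, Store.putNat, hq]
    · simp [Store.setNat, NatExp.eval]
    · simp [Store.setNat, NatExp.eval, hq, hn]
  · intro h
    simp only [Test.Holds, NatExp.eval, Store.putNat, h0, Function.update_self] at h
    have hq : q + c = (q % n + c) + n * (q / n) := by omega
    refine Spec.setNat hn (by simp [NatExp.cost]) ⟨?_, ?_, ?_, ?_⟩
    · simp [Store.setNat, Store.putNat, h0]
    · have hmod : (q + c) % n = q % n + c := by
        rw [hq, Nat.add_mul_mod_self_left, Nat.mod_eq_of_lt (by omega)]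
      simp [Store.setNat, Store.putNat, hmod]
    · simp [Store.setNat, NatExp.eval]
    · simp only [Store.setNat, NatExp.eval, Function.update_self]
      rw [hq, Nat.add_mul_div_left _ _ hn, Nat.div_eq_of_lt (a := q % n + c) (by omega)]
      omega

/-- Digit `j` of `m` in base `n`. -/
abbrev digit (n m j : ℕ) : ℕ := m / n ^ j % n

/-- Before position `p` the invariant is `m / n ^ p + carry = (m + 1) / n ^ p`. At `p = D` the first
quotient is `0`, so the final carry is set exactly when the counter has run through all strings. -/
theorem Spec.increment (hn : 0 < n) {l D m : ℕ} {σ : Store} (h0 : σ.nat 0 = n)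
    (hD : σ.nat (dimVar l) = D) (hm : m < n ^ D) (hd : ∀ j < D, σ.natArr l j = digit n m j) :
    Spec G (.increment l) σ (D + 30) fun τ =>
      (∀ j < D, τ.natArr l j = digit n (m + 1) j) ∧
      (τ.nat (carryVar l) < 1 ↔ m + 1 < n ^ D) := by
  refine Spec.seq hn (a := 1) (b := D + 28) (R := fun τ => τ = σ.setNat (carryVar l) 1)
    (Spec.setNat hn (by simp [NatExp.cost]) (by simp [NatExp.eval])) (by omega) ?_
  rintro _ - rfl
  refine (Spec.forLoop hn (N := D) (h := D) (a := 15) (fun p τ => τ.nat 0 = n ∧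
      (∀ j < p, τ.natArr l j = digit n (m + 1) j) ∧
      (∀ j, p ≤ j → j < D → τ.natArr l j = digit n m j) ∧
      τ.nat (carryVar l) ≤ 1 ∧ m / n ^ p + τ.nat (carryVar l) = (m + 1) / n ^ p)
    (by simp) (by simp [Program.incrementDigit, Program.WritesNat])
    (by simp [Program.incrementDigit, Program.WritesNat]) (by simp [Store.setNat, hD])
    (le_pow_self hn _) (by omega) ?_ ?_ ?_).mono le_rfl ?_
  · intro p τ v hτ
    simpa [Store.setNat] using hτ
  · simpa [Store.setNat, h0] using hd
  · rintro p hp τ hpos ⟨h1, h2, h3, h4, h5⟩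
    refine (Spec.incrementDigit hn (l := l) (q := m / n ^ p) (c := τ.nat (carryVar l)) h1
      (by rw [hpos]; exact h3 p le_rfl hp) rfl h4).mono le_rfl ?_
    rintro ρ - ⟨g1, g2, g3, g4⟩
    rw [h5, hpos] at g2
    rw [h5, Nat.div_div_eq_div_mul, Nat.div_div_eq_div_mul, ← pow_succ] at g4
    refine ⟨g1, fun j hj => ?_, fun j hj hjD => ?_, g3, g4⟩
    · rw [g2]
      rcases eq_or_ne j p with rfl | hne
      · rw [Function.update_self]
      · rw [Function.update_of_ne hne]
        exact h2 j (by omega)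
    · rw [g2, Function.update_of_ne (by omega)]
      exact h3 j (by omega) hjD
  · rintro τ - ⟨-, h2, -, h4, h5⟩
    refine ⟨h2, ?_⟩
    rw [Nat.div_eq_of_lt hm] at h5
    have : (m + 1) / n ^ D = 0 ↔ m + 1 < n ^ D := by
      rw [Nat.div_eq_zero_iff]
      have : 0 < n ^ D := by positivity
      omega
    omega

/-- The carry left by the increment serves as the stopping signal, so the number `n ^ D` is never
computed. The invariant has to survive changes of the counter (`hI`), and the body must leave the
counter's digits alone. -/
theorem Spec.enumerate (hn : 0 < n) {l D a e : ℕ} {c : Program M} {σ : Store}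
    (I : ℕ → Store → Prop) (hI : ∀ m σ τ, SameExceptCounter l σ τ → I m σ → I m τ)
    (h0 : σ.nat 0 = n) (hD : σ.nat (dimVar l) = D)
    (hc0 : ¬ c.WritesNat 0) (hcD : ¬ c.WritesNat (dimVar l)) (hcl : ¬ c.WritesNatArr l)
    (he : a + 3 * D + 60 ≤ e) (hI0 : I 0 σ)
    (hstep : ∀ m < n ^ D, ∀ σ, σ.nat 0 = n → (∀ j < D, σ.natArr l j = digit n m j) →
      I m σ → Spec G c σ a (I (m + 1))) :
    Spec G (.enumerate l c) σ e (I (n ^ D)) := by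
  refine Spec.seq hn (a := D + 12) (b := a + 2 * D + 40)
    (R := fun τ => τ.nat 0 = n ∧ τ.nat (dimVar l) = D ∧ I 0 τ ∧ ∀ j < D, τ.natArr l j = 0)
    ?_ (by omega) ?_
  · refine Spec.forLoop hn (N := D) (h := D) (a := 2)
      (fun p τ => τ.nat 0 = n ∧ τ.nat (dimVar l) = D ∧ I 0 τ ∧ ∀ j < p, τ.natArr l j = 0)
      (by simp) (by simp [Program.WritesNat]) (by simp [Program.WritesNat]) hD
      (le_pow_self hn _) (by omega) ?_ ⟨h0, hD, hI0, by simp⟩ ?_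
    · rintro p τ v ⟨h1, h2, h3, h4⟩
      refine ⟨by simp [Store.setNat, h1], by simp [Store.setNat, h2], hI _ _ _ ?_ h3, h4⟩
      exact ⟨fun x _ hx => Function.update_of_ne hx _ _, rfl, fun _ _ => rfl, rfl⟩
    · rintro p hp τ hpos ⟨h1, h2, h3, h4⟩
      refine Spec.putNat hn (by simp [NatExp.cost]) ⟨h1, h2, hI _ _ _ ?_ h3, ?_⟩
      · exact ⟨fun x _ _ => rfl, rfl, fun x hx => Function.update_of_ne hx _ _, rfl⟩
      · intro j hj
        rcases eq_or_ne j p with rfl | hne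
        · simp [Store.putNat, NatExp.eval, hpos]
        · simp only [Store.putNat, NatExp.eval, hpos, Function.update_self,
            Function.update_of_ne hne]
          exact h4 j (by omega)
  · rintro τ - ⟨h1, h2, h3, h4⟩
    refine Spec.seq hn (a := 1) (b := a + 2 * D + 38)
      (R := fun τ => (τ.nat (carryVar l) < 1 ↔ 0 < n ^ D) ∧ τ.nat 0 = n ∧
        τ.nat (dimVar l) = D ∧ I 0 τ ∧ ∀ j < D, τ.natArr l j = digit n 0 j)
      (Spec.setNat hn (by simp [NatExp.cost]) ⟨?_, ?_, ?_, ?_, ?_⟩) (by omega) ?_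
    · simp [Store.setNat, NatExp.eval, hn]
    · simp [Store.setNat, h1]
    · simp [Store.setNat, h2]
    · exact hI _ _ _ ⟨fun x hx _ => Function.update_of_ne hx _ _, rfl, fun _ _ => rfl, rfl⟩ h3
    · simpa [Store.setNat, digit] using h4
    · intro ρ _ hρ
      refine (Spec.loop hn (N := n ^ D) (h := D + 1) (a := a + D + 31)
        (fun m τ => (τ.nat (carryVar l) < 1 ↔ m < n ^ D) ∧ τ.nat 0 = n ∧
          τ.nat (dimVar l) = D ∧ I m τ ∧ ∀ j < D, τ.natArr l j = digit n m j)
        ?_ (by simp only [Test.cost, NatExp.cost]; omega) hρ ?_ ?_).mono le_rfl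
        fun _ _ h => h.2.2.2.1
      -- The extra exponent in `h := D + 1` pays for the last test after `n ^ D` rounds.
      · have h1 : n ^ D ≤ (n + 1) ^ D := Nat.pow_le_pow_left (by omega) D
        have h2 : 1 ≤ (n + 1) ^ D := Nat.one_le_pow _ _ (by omega)
        rw [pow_succ]
        nlinarith
      · rintro m hm υ ⟨g1, g2, g3, g4, g5⟩
        refine ⟨by simpa [Test.Holds, NatExp.eval] using g1.2 hm, ?_⟩
        refine Spec.seq hn (b := D + 30) (hstep m hm υ g2 g5 g4) (by omega) fun χ hf hχ => ?_
        have k1 : χ.nat 0 = n := by rw [hf.nat _ hc0, g2]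
        have k2 : χ.nat (dimVar l) = D := by rw [hf.nat _ hcD, g3]
        refine (Spec.increment hn (l := l) k1 k2 hm (by rwa [hf.natArr _ hcl])).mono le_rfl ?_
        rintro ω hω ⟨f1, f2⟩
        have hs := hω.sameExceptCounter
        refine ⟨f2, ?_, ?_, hI _ _ _ hs hχ, f1⟩
        · rw [hs.nat _ (by simp) (by simp), k1]
        · rw [hs.nat _ (by simp) (by simp), k2]
      · rintro υ ⟨g1, -⟩
        simpa [Test.Holds, NatExp.eval] using g1

theorem exists_digits_eq {D : ℕ} (a : ℕ → ℕ) (ha : ∀ j < D, a j < n) :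
    ∃ m < n ^ D, ∀ j < D, digit n m j = a j := by
  refine ⟨finFunctionFinEquiv fun j : Fin D => ⟨a j, ha j j.2⟩, Fin.is_lt _, fun j hj => ?_⟩
  have := finFunctionFinEquiv_symm_apply_val
    (finFunctionFinEquiv fun j : Fin D => (⟨a j, ha j j.2⟩ : Fin n)) ⟨j, hj⟩
  rw [Equiv.symm_apply_apply] at this
  exact this.symm

theorem sum_range_pow_digits (hn : 0 < n) {D : ℕ} (F : (Fin D → Fin n) → ℝ) :
    ∑ m ∈ Finset.range (n ^ D), F (fun j => ⟨digit n m j, Nat.mod_lt _ hn⟩) = ∑ a, F a := by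
  rw [Finset.sum_range, ← Equiv.sum_comp (finFunctionFinEquiv (m := n) (n := D)).symm F]
  refine Finset.sum_congr rfl fun m _ => ?_
  refine congrArg F (funext fun j => ?_)
  exact Fin.ext (finFunctionFinEquiv_symm_apply_val m j).symm

theorem empirical_congr {k : ℕ} {d d' : ℕ → ℕ} (h : ∀ j < k, d j = d' j) :
    empirical k n d = empirical k n d' := by
  funext s
  exact Finset.sum_congr rfl fun j hj => by rw [h j (Finset.mem_range.1 hj)]

/-! ### The search -/

/-- The product of a constant and an expression. -/
def NatExp.nsmul (e : NatExp) : ℕ → NatExp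
  | 0 => .lit 0
  | i + 1 => .add (nsmul e i) e

theorem NatExp.eval_nsmul (e : NatExp) (i : ℕ) (σ : Store) :
    (e.nsmul i).eval σ = i * e.eval σ := by
  induction i with
  | zero => simp [nsmul, eval]
  | succ i ih => simp only [nsmul, eval, ih]; ring

theorem NatExp.cost_nsmul (e : NatExp) (i : ℕ) : (e.nsmul i).cost = i * (e.cost + 1) + 1 := by
  induction i with
  | zero => simp [nsmul, cost]
  | succ i ih => simp only [nsmul, cost, ih]; ring

/-- The parameters of the search: `n` and `k`, the lengths of the digit strings, and `ε`. -/
structure Store.Ready (M n k : ℕ) (eps : ℝ) (σ : Store) : Prop where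
  pureStrategies : σ.nat 0 = n
  profileDigits : σ.nat (dimVar 0) = M * k
  samples : σ.nat (dimVar 1) = k
  players : σ.nat (dimVar 2) = M
  accuracy : σ.real 0 = eps
  realSamples : σ.real 3 = k

/-- The program does not change the parameters of the search. -/
def Program.KeepsParameters (c : Program M) : Prop :=
  (¬ c.WritesNat 0 ∧ ¬ c.WritesNat (dimVar 0) ∧ ¬ c.WritesNat (dimVar 1) ∧
    ¬ c.WritesNat (dimVar 2)) ∧ ¬ c.WritesReal 0 ∧ ¬ c.WritesReal 3

theorem Store.Ready.of_framed {k : ℕ} {eps : ℝ} {σ τ : Store} {c : Program M}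
    (h : σ.Ready M n k eps) (hf : Framed c σ τ) (hc : c.KeepsParameters) : τ.Ready M n k eps := by
  obtain ⟨⟨h1, h2, h3, h4⟩, h5, h6⟩ := hc
  exact ⟨(hf.nat _ h1).trans h.1, (hf.nat _ h2).trans h.2, (hf.nat _ h3).trans h.3,
    (hf.nat _ h4).trans h.4, (hf.real _ h5).trans h.5, (hf.real _ h6).trans h.6⟩

theorem Store.Ready.of_sameExceptCounter {k l : ℕ} {eps : ℝ} {σ τ : Store}
    (h : σ.Ready M n k eps) (hs : SameExceptCounter l σ τ) : τ.Ready M n k eps :=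
  ⟨(hs.nat _ (by simp) (by simp)).trans h.1,
    (hs.nat _ (by simp only [dimVar, carryVar]; omega)
      (by simp only [dimVar, posVar]; omega)).trans h.2,
    (hs.nat _ (by simp only [dimVar, carryVar]; omega)
      (by simp only [dimVar, posVar]; omega)).trans h.3,
    (hs.nat _ (by simp only [dimVar, carryVar]; omega)
      (by simp only [dimVar, posVar]; omega)).trans h.4,
    by rw [hs.real, h.5], by rw [hs.real, h.6]⟩

/-- Store in the real array `dst` the empirical distribution of the `i`-th block of `k` digits of
the digit string of level `l`. -/
def Program.load (l i dst : ℕ) : Program M :=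
  .seq (.forLoop 3 0 (.putReal dst (.var 3) (.lit 0)))
    (.forLoop 3 (dimVar 1)
      (.putReal dst (.get l (.add ((NatExp.var (dimVar 1)).nsmul i) (.var 3)))
        (.add (.get dst (.get l (.add ((NatExp.var (dimVar 1)).nsmul i) (.var 3))))
          (.div (.lit 1) (.var 3)))))

/-- After the array is cleared, each digit adds `1 / k` at its position, so the array holds the
partial sums that define the empirical distribution. -/
theorem Spec.load (hn : 0 < n) {k l i dst e : ℕ} {eps : ℝ} {σ : Store} (hσ : σ.Ready M n k eps)
    (he : 4 * i + k + 40 ≤ e) :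
    Spec G (.load l i dst) σ e fun τ =>
      ∀ s : Fin n, τ.realArr dst s = empirical k n (fun j => σ.natArr l (i * k + j)) s := by
  refine Spec.seq hn (a := 13) (b := 4 * i + k + 25)
    (R := fun τ => ∀ s < n, τ.realArr dst s = 0) ?_ (by omega) ?_
  · refine Spec.forLoop hn (N := n) (h := 1) (a := 2)
      (fun p τ => ∀ s < p, τ.realArr dst s = 0)
      (by simp) (by simp [Program.WritesNat]) (by simp [Program.WritesNat]) hσ.1
      (by simp) (by omega) (fun _ _ _ h => h) (by simp) ?_
    intro p hp τ hpos h
    refine Spec.putReal (by simpa [NatExp.cost, RealExp.cost] using le_pow_self hn 2) ?_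
    intro s hs
    rcases eq_or_ne s p with rfl | hne
    · simp [Store.putReal, NatExp.eval, RealExp.eval, hpos]
    · simp only [Store.putReal, NatExp.eval, hpos, Function.update_self,
        Function.update_of_ne hne]
      exact h s (by omega)
  · intro τ hf hτ
    have hτR := hσ.of_framed hf (by simp [dimVar, Program.KeepsParameters, Program.forLoop,
      Program.WritesNat, Program.WritesReal])
    have hτl : τ.natArr l = σ.natArr l := hf.natArr _ (by simp [Program.forLoop,
      Program.WritesNatArr])
    refine (Spec.forLoop hn (N := k) (h := k) (a := 4 * i + 13)
      (fun p ρ => ρ.nat (dimVar 1) = k ∧ ρ.real 3 = k ∧ ρ.natArr l = σ.natArr l ∧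
        ∀ s : Fin n, ρ.realArr dst s =
          ∑ j ∈ Finset.range p, if σ.natArr l (i * k + j) = s then 1 / (k : ℝ) else 0)
      (by simp) (by simp [Program.WritesNat]) (by simp [Program.WritesNat]) hτR.samples
      (le_pow_self hn k) (by omega) ?_ ?_ ?_).mono le_rfl fun _ _ h => h.2.2.2
    · rintro p ρ v ⟨h1, h2, h3, h4⟩
      exact ⟨by simp [Store.setNat, h1], h2, h3, h4⟩
    · exact ⟨hτR.samples, hτR.realSamples, hτl, fun s => by simp [hτ s s.2]⟩
    · rintro p hp ρ hpos ⟨h1, h2, h3, h4⟩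
      refine Spec.putReal (le_trans ?_ (le_pow_self hn _)) ⟨h1, h2, h3, fun s => ?_⟩
      · simp only [NatExp.cost, RealExp.cost, NatExp.cost_nsmul]
        omega
      · simp only [Store.putReal, NatExp.eval, NatExp.eval_nsmul, RealExp.eval, hpos, h1, h2, h3,
          Function.update_self, Finset.sum_range_succ, Rat.cast_one]
        split_ifs with h
        · rw [h, Function.update_self, h4]
        · rw [Function.update_of_ne (Ne.symm h), h4, add_zero]

/-- The product of the probabilities of the first `m` entries of the pure profile in the natural
number array `2`, where the strategy of player `j` is in the real array `loc j`. -/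
def RealExp.profileProb (loc : ℕ → ℕ) : ℕ → RealExp M
  | 0 => .lit 1
  | m + 1 => .mul (profileProb loc m) (.get (loc m) (.get 2 (.lit m)))

theorem RealExp.eval_profileProb (loc : ℕ → ℕ) (m : ℕ) (σ : Store) :
    (profileProb (M := M) loc m).eval G σ =
      ∏ j ∈ Finset.range m, σ.realArr (loc j) (σ.natArr 2 j) := by
  induction m with
  | zero => simp [profileProb, eval]
  | succ m ih => simp [profileProb, eval, ih, Finset.prod_range_succ, NatExp.eval]

theorem RealExp.cost_profileProb (loc : ℕ → ℕ) (m : ℕ) :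
    (profileProb (M := M) loc m).cost n = 4 * m + 1 := by
  induction m with
  | zero => simp [profileProb, cost]
  | succ m ih => simp only [profileProb, cost, ih, NatExp.cost]; ring

/-- Compute the utility of player `i` in the real variable `r`, where the strategy of player `j` is
in the real array `loc j`. -/
def Program.utility (i : Fin M) (loc : ℕ → ℕ) (r : ℕ) : Program M :=
  .seq (.setReal r (.lit 0))
    (.seq (.enumerate 2
      (.setReal r (.add (.var r) (.mul (.profileProb loc M) (.payoff i 2)))))
      (.setReal r (.sub (.var r) (.penalty i (loc i)))))

theorem Spec.utility (hn : 0 < n) {k r e : ℕ} {i : Fin M} {loc : ℕ → ℕ} {eps : ℝ} {σ : Store}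
    (hσ : σ.Ready M n k eps) (he : 8 * M + 80 ≤ e) :
    Spec G (.utility i loc r) σ e fun τ =>
      τ.real r = G.utility i fun j s => σ.realArr (loc j) s := by
  refine Spec.seq hn (a := 1) (b := 8 * M + 75) (R := fun τ => τ = σ.setReal r 0)
    (Spec.setReal (by simpa [RealExp.cost] using le_pow_self hn 1) (by simp [RealExp.eval]))
    (by omega) ?_
  rintro _ - rfl
  refine Spec.seq hn (a := 8 * M + 65) (b := 3)
    (R := fun τ => τ.realArr = σ.realArr ∧
      τ.real r = G.expectedPayoff i fun j s => σ.realArr (loc j) s) ?_ (by omega) ?_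
  · refine Spec.mono (Spec.enumerate hn (D := M) (a := 5 * M + 5)
      (fun m τ => τ.realArr = σ.realArr ∧ τ.real r = ∑ m' ∈ Finset.range m,
        (∏ j : Fin M, σ.realArr (loc j) (digit n m' j)) *
          G.payoff i fun j => ⟨digit n m' j, Nat.mod_lt _ hn⟩) ?_
      hσ.pureStrategies hσ.players (by simp [Program.WritesNat]) (by simp [Program.WritesNat])
      (by simp [Program.WritesNatArr]) (by omega) ?_ ?_) le_rfl ?_
    · rintro m τ ρ hs ⟨h1, h2⟩
      exact ⟨hs.realArr.trans h1, by rw [hs.real, h2]⟩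
    · exact ⟨rfl, by simp [Store.setReal]⟩
    · rintro m hm τ - hd ⟨h1, h2⟩
      refine Spec.setReal (le_trans ?_ (le_pow_self hn _)) ⟨h1, ?_⟩
      · simp only [RealExp.cost, RealExp.cost_profileProb]
        omega
      -- Digits are below `n`, so the look-up never returns its default value.
      · have hlt : ∀ j : Fin M, τ.natArr 2 j < n := fun j => by
          rw [hd j j.2]; exact Nat.mod_lt _ hn
        simp only [Store.setReal, RealExp.eval, RealExp.eval_profileProb, Function.update_self,
          dif_pos hlt, h1, h2, Finset.sum_range_succ, Finset.prod_range]
        congr 2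
        · exact Finset.prod_congr rfl fun j _ => by rw [hd j j.2]
        · congr 1
          funext j
          exact Fin.ext (hd j j.2)
    · rintro τ - ⟨h1, h2⟩
      refine ⟨h1, h2.trans ?_⟩
      exact sum_range_pow_digits hn
        fun a => (∏ j : Fin M, σ.realArr (loc j) (a j)) * G.payoff i a
  · rintro τ - ⟨h1, h2⟩
    refine Spec.setReal ?_ ?_
    · simp only [RealExp.cost]
      nlinarith [sq_nonneg ((n : ℤ) - 1), pow_succ (n + 1) 2, Nat.pow_le_pow_left
        (show 2 ≤ n + 1 by omega) 2]
    · simp [Store.setReal, RealExp.eval, h1, h2, PenaltyGame.utility]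

/-- Where the strategies are found after a deviation of player `i`. -/
def deviationLoc (M i j : ℕ) : ℕ := if j = i then M else j

/-- Raise the flag `1` if player `i` gains more than `2ε` by playing the empirical distribution of
the digits of level `1`. -/
def Program.tryDeviation (i : Fin M) : Program M :=
  .seq (.load 1 0 M) (.seq (.utility i (deviationLoc M i) 5)
    (.branch (.realLt (.add (.var 4) (.mul (.lit 2) (.var 0))) (.var 5))
      (.setNat 1 (.lit 1)) .skip))

/-- Raise the flag `1` if player `i` has a deviation that gains more than `2ε`. -/
def Program.checkPlayer (i : Fin M) : Program M :=
  .seq (.utility i id 4) (.enumerate 1 (.tryDeviation i))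

/-- The deviation of player `i` to the empirical distribution of the digits of `m` gains at most
`2ε`. -/
def PenaltyGame.PassesDeviation (G : PenaltyGame M n) (eps : ℝ) (k : ℕ) (X : Fin M → Fin n → ℝ)
    (i : Fin M) (m : ℕ) : Prop :=
  G.utility i (Function.update X i (empirical k n (digit n m))) ≤ G.utility i X + 2 * eps

/-- Only the first `k` samples matter, and these are the digits of some number below `n ^ k`; the
test is therefore a finite check. -/
theorem PenaltyGame.passesTest_iff (hn : 0 < n) {eps : ℝ} {k : ℕ} {X : Fin M → Fin n → ℝ} :
    G.PassesTest eps k X ↔ ∀ i, ∀ m < n ^ k, G.PassesDeviation eps k X i m := by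
  refine forall_congr' fun i => ⟨fun h m _ => ?_, fun h a => ?_⟩
  · exact h fun j => ⟨digit n m j, Nat.mod_lt _ hn⟩
  · obtain ⟨m, hm, h'⟩ := exists_digits_eq (fun j => a j) fun j (_ : j < k) => (a j).2
    have := h m hm
    rwa [PassesDeviation, empirical_congr h'] at this

theorem Spec.tryDeviation (hn : 0 < n) {k m e : ℕ} {i : Fin M} {eps : ℝ} {σ : Store}
    (hσ : σ.Ready M n k eps) (hd : ∀ j < k, σ.natArr 1 j = digit n m j)
    (hu : σ.real 4 = G.utility i fun j s => σ.realArr j s) (he : k + 8 * M + 140 ≤ e) :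
    Spec G (.tryDeviation i) σ e fun τ =>
      (τ.nat 1 = 0 ↔ σ.nat 1 = 0 ∧ G.PassesDeviation eps k (fun (j : Fin M) (s : Fin n) => σ.realArr j s) i m) := by
  refine Spec.seq hn (b := 8 * M + 95) (Spec.load hn hσ le_rfl) (by omega) ?_
  intro τ hf hτ
  have hτR := hσ.of_framed hf (by simp [dimVar, Program.KeepsParameters, Program.load, Program.forLoop,
      Program.WritesNat, Program.WritesReal])
  have h1 : τ.nat 1 = σ.nat 1 := hf.nat _ (by simp [Program.load, Program.forLoop,
      Program.WritesNat])
  have h4 : τ.real 4 = σ.real 4 := hf.real _ (by simp [Program.load, Program.forLoop,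
      Program.WritesReal])
  -- The deviation lives in the spare array `M`, so the tested profile in the arrays below `M` is
  -- not overwritten.
  have hX : (fun (j : Fin M) (s : Fin n) => τ.realArr (deviationLoc M i j) s) =
      Function.update (fun (j : Fin M) (s : Fin n) => σ.realArr j s) i (empirical k n (digit n m)) := by
    funext j s
    rcases eq_or_ne j i with rfl | h
    · rw [Function.update_self, deviationLoc, if_pos rfl, hτ s]
      exact congrFun (empirical_congr fun j hj => by simpa using hd j hj) s
    · rw [Function.update_of_ne h, deviationLoc, if_neg (fun h' => h (Fin.ext h')),
        hf.realArr]
      simp [Program.load, Program.forLoop, Program.WritesRealArr, j.2.ne]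
  refine Spec.seq hn (b := 10) (Spec.utility hn hτR le_rfl) (by omega) ?_
  intro ρ hg hρ
  rw [hX] at hρ
  have g0 : ρ.real 0 = eps := (hg.real _ (by simp [Program.utility, Program.enumerate,
    Program.increment, Program.incrementDigit, Program.forLoop, Program.WritesReal])).trans
    hτR.accuracy
  have g1 : ρ.nat 1 = σ.nat 1 := (hg.nat _ (by simp [Program.utility, Program.enumerate,
    Program.increment, Program.incrementDigit, Program.forLoop, Program.WritesNat])).trans h1
  have g4 : ρ.real 4 = σ.real 4 := (hg.real _ (by simp [Program.utility, Program.enumerate,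
    Program.increment, Program.incrementDigit, Program.forLoop, Program.WritesReal])).trans h4
  refine Spec.branch hn (a := 1) (by simp [Test.cost, RealExp.cost]) ?_ ?_
  · intro h
    simp only [Test.Holds, RealExp.eval, g0, g4, hρ, hu, Rat.cast_ofNat] at h
    refine Spec.setNat hn (by simp [NatExp.cost]) ?_
    simp [Store.setNat, NatExp.eval, PenaltyGame.PassesDeviation, h]
  · intro h
    simp only [Test.Holds, RealExp.eval, g0, g4, hρ, hu, Rat.cast_ofNat, not_lt] at h
    refine Spec.skip ?_
    simp [g1, PenaltyGame.PassesDeviation, h]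

theorem Program.keepsParameters_tryDeviation (i : Fin M) : (tryDeviation i).KeepsParameters := by
  simp [dimVar, KeepsParameters, tryDeviation, load, utility, enumerate, increment, incrementDigit,
    forLoop, WritesNat, WritesReal]

theorem Program.keepsParameters_checkPlayer (i : Fin M) : (checkPlayer i).KeepsParameters := by
  simp [dimVar, carryVar, KeepsParameters, checkPlayer, tryDeviation, load, utility, enumerate, increment,
    incrementDigit, forLoop, WritesNat, WritesReal]

theorem Program.writesRealArr_checkPlayer {i : Fin M} {j : ℕ} (hj : j < M) :
    ¬ (checkPlayer i).WritesRealArr j := by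
  simp [checkPlayer, tryDeviation, load, utility, enumerate, increment,
    incrementDigit, forLoop, WritesRealArr, hj.ne]

theorem Spec.checkPlayer (hn : 0 < n) {k e : ℕ} {i : Fin M} {eps : ℝ} {σ : Store}
    (hσ : σ.Ready M n k eps) (he : 4 * k + 16 * M + 300 ≤ e) :
    Spec G (.checkPlayer i) σ e fun τ =>
      (τ.nat 1 = 0 ↔ σ.nat 1 = 0 ∧
        ∀ m < n ^ k, G.PassesDeviation eps k (fun (j : Fin M) (s : Fin n) => σ.realArr j s) i m) := by
  refine Spec.seq hn (b := 4 * k + 8 * M + 210) (Spec.utility hn hσ le_rfl) (by omega) ?_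
  intro τ hf hτ
  have hτR := hσ.of_framed hf (by simp [dimVar, Program.KeepsParameters, Program.utility,
    Program.enumerate, Program.increment, Program.incrementDigit, Program.forLoop,
    Program.WritesNat, Program.WritesReal])
  have h1 : τ.nat 1 = σ.nat 1 := hf.nat _ (by simp [Program.utility,
    Program.enumerate, Program.increment, Program.incrementDigit, Program.forLoop,
    Program.WritesNat])
  refine Spec.mono (Spec.enumerate hn (D := k) (a := k + 8 * M + 140)
    -- The reference utility is computed once and kept in real variable `4`; flag `1` is only ever
    -- raised, so it records whether any deviation so far has failed the test.
    (fun m ρ => ρ.Ready M n k eps ∧ (∀ j < M, ρ.realArr j = σ.realArr j) ∧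
      (ρ.real 4 = G.utility i fun j s => σ.realArr j s) ∧
      (ρ.nat 1 = 0 ↔ σ.nat 1 = 0 ∧
        ∀ m' < m, G.PassesDeviation eps k (fun (j : Fin M) (s : Fin n) => σ.realArr j s) i m'))
    ?_ hτR.pureStrategies hτR.samples (Program.keepsParameters_tryDeviation i).1.1
    (Program.keepsParameters_tryDeviation i).1.2.2.1
    (by simp [Program.tryDeviation, Program.load, Program.utility,
      Program.enumerate, Program.increment, Program.incrementDigit, Program.forLoop,
      Program.WritesNatArr]) (by omega) ?_ ?_) le_rfl fun _ _ h => h.2.2.2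
  · rintro m ρ χ hs ⟨g1, g2, g3, g4⟩
    exact ⟨g1.of_sameExceptCounter hs, fun j hj => by rw [hs.realArr, g2 j hj],
      by rw [hs.real, g3], by rw [hs.nat 1 (by simp) (by simp), g4]⟩
  · refine ⟨hτR, fun j hj => hf.realArr _ ?_, hτ, by simp [h1]⟩
    simp [Program.utility, Program.enumerate, Program.increment, Program.incrementDigit,
      Program.forLoop, Program.WritesRealArr]
  · rintro m hm ρ - hd ⟨g1, g2, g3, g4⟩
    have hX : (fun (j : Fin M) (s : Fin n) => ρ.realArr j s) =
        fun (j : Fin M) (s : Fin n) => σ.realArr j s := by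
      funext j s
      rw [g2 j j.2]
    refine (Spec.tryDeviation hn g1 hd (by rw [hX, g3]) le_rfl).mono le_rfl ?_
    intro χ hg hχ
    rw [hX, g4] at hχ
    refine ⟨g1.of_framed hg (Program.keepsParameters_tryDeviation i), fun j hj => ?_, ?_, ?_⟩
    · rw [hg.realArr _ (by simp [Program.tryDeviation, Program.load, Program.utility,
        Program.enumerate, Program.increment, Program.incrementDigit, Program.forLoop,
        Program.WritesRealArr, hj.ne]), g2 j hj]
    · rw [hg.real _ (by simp [Program.tryDeviation, Program.load, Program.utility,
        Program.enumerate, Program.increment, Program.incrementDigit, Program.forLoop,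
        Program.WritesReal]), g3]
    · rw [hχ, and_assoc, Nat.forall_lt_succ_right]

/-- Test the profile given by the digits of level `0`: store it in the real arrays, and raise the
flag `2` if it passes. -/
def Program.testProfile : Program M :=
  .seq (.chain (fun i => .load 0 i i) M) (.seq (.setNat 1 (.lit 0))
    (.seq (.chain (fun i => if h : i < M then .checkPlayer ⟨i, h⟩ else .skip) M)
      (.branch (.natLt (.var 1) (.lit 1)) (.setNat 2 (.lit 1)) .skip)))

/-- The profile of empirical distributions of the blocks of `k` digits of `m`. -/
noncomputable def digitProfile (M n k m : ℕ) : Fin M → Fin n → ℝ :=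
  fun i => empirical k n fun j => digit n m (i * k + j)

theorem Program.keepsParameters_chain {f : ℕ → Program M} {m : ℕ}
    (h : ∀ i, (f i).KeepsParameters) : (chain f m).KeepsParameters :=
  ⟨⟨writesNat_chain fun i => (h i).1.1, writesNat_chain fun i => (h i).1.2.1,
    writesNat_chain fun i => (h i).1.2.2.1, writesNat_chain fun i => (h i).1.2.2.2⟩,
    writesReal_chain fun i => (h i).2.1, writesReal_chain fun i => (h i).2.2⟩

theorem Program.keepsParameters_load (l i dst : ℕ) :
    (load (M := M) l i dst).KeepsParameters := by
  simp [dimVar, KeepsParameters, load, forLoop, WritesNat, WritesReal]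

theorem Program.KeepsParameters.seq {c d : Program M} (hc : c.KeepsParameters)
    (hd : d.KeepsParameters) : (Program.seq c d).KeepsParameters := by
  simp only [KeepsParameters, WritesNat, WritesReal] at *
  tauto

theorem Program.keepsParameters_testProfile : (testProfile (M := M)).KeepsParameters := by
  refine (keepsParameters_chain fun i => keepsParameters_load _ _ _).seq (.seq ?_ (.seq
    (keepsParameters_chain fun i => ?_) ?_))
  · simp [dimVar, KeepsParameters, WritesNat, WritesReal]
  · split_ifs
    · exact keepsParameters_checkPlayer _
    · simp [KeepsParameters, WritesNat, WritesReal]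
  · simp [dimVar, KeepsParameters, WritesNat, WritesReal]

theorem Spec.testProfile (hn : 0 < n) {k m e : ℕ} {eps : ℝ} {σ : Store}
    (hσ : σ.Ready M n k eps) (hd : ∀ j < M * k, σ.natArr 0 j = digit n m j)
    (h2 : σ.nat 2 = 0) (he : M * (5 * k + 20 * M + 350) + 20 ≤ e) :
    Spec G .testProfile σ e fun τ =>
      (τ.nat 2 = 0 ∧ ¬ G.PassesTest eps k (digitProfile M n k m)) ∨
      (τ.nat 2 = 1 ∧ G.PassesTest eps k (digitProfile M n k m) ∧
        τ.outputProfile M n = digitProfile M n k m) := by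
  refine Spec.seq hn (a := M * (4 * M + k + 41)) (b := M * (4 * k + 16 * M + 301) + 12)
    (R := fun τ => τ.Ready M n k eps ∧ τ.nat 2 = 0 ∧
      τ.outputProfile M n = digitProfile M n k m) ?_ (le_trans ?_ he) ?_
  · refine (Spec.chain hn (N := M) (a := 4 * M + k + 40)
      (fun p τ => τ.Ready M n k eps ∧ τ.nat 2 = 0 ∧ τ.natArr 0 = σ.natArr 0 ∧
        ∀ i : Fin M, (i : ℕ) < p → ∀ s : Fin n, τ.realArr i s = digitProfile M n k m i s)
      le_rfl ⟨hσ, h2, rfl, by simp⟩ ?_).mono le_rfl ?_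
    · rintro p hp τ ⟨g1, g2, g3, g4⟩
      refine (Spec.load hn g1 (by omega)).mono le_rfl fun ρ hf hρ => ?_
      refine ⟨g1.of_framed hf (Program.keepsParameters_load _ _ _), ?_, ?_, ?_⟩
      · rw [hf.nat _ (by simp [Program.load, Program.forLoop, Program.WritesNat]), g2]
      · rw [hf.natArr _ (by simp [Program.load, Program.forLoop, Program.WritesNatArr]), g3]
      · intro i hi s
        rcases eq_or_ne (i : ℕ) p with h | h
        -- Block `i` occupies the positions `i * k` to `i * k + k - 1`, all below `M * k`.
        · rw [h, hρ s, g3, digitProfile]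
          refine congrFun (empirical_congr fun j hj => ?_) s
          rw [← h]
          refine hd _ ?_
          calc (i : ℕ) * k + j < (i + 1) * k := by rw [add_mul]; omega
            _ ≤ M * k := Nat.mul_le_mul_right _ i.2
        · rw [hf.realArr _ (by simp [Program.load, Program.forLoop, Program.WritesRealArr, h])]
          exact g4 i (by omega) s
    · rintro τ - ⟨g1, g2, -, g4⟩
      exact ⟨g1, g2, funext fun i => funext fun s => g4 i i.2 s⟩
  · ring_nf; omega
  rintro τ - ⟨g1, g2, g3⟩
  refine Spec.seq hn (a := 1) (b := M * (4 * k + 16 * M + 301) + 10)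
    (R := fun ρ => ρ = τ.setNat 1 0)
    (Spec.setNat hn (by simp [NatExp.cost]) (by simp [NatExp.eval])) (by omega) ?_
  rintro ρ hf hρ
  have k1 : ρ.Ready M n k eps :=
    g1.of_framed hf (by simp [dimVar, Program.KeepsParameters, Program.WritesNat, Program.WritesReal])
  have k2 : ρ.nat 2 = 0 := by simp [hρ, Store.setNat, g2]
  have k3 : ρ.outputProfile M n = digitProfile M n k m := by rw [hρ]; exact g3
  have k4 : ρ.nat 1 = 0 := by simp [hρ, Store.setNat]
  refine Spec.seq hn (a := M * (4 * k + 16 * M + 301)) (b := 6)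
    (R := fun χ => χ.nat 2 = 0 ∧ χ.outputProfile M n = digitProfile M n k m ∧
      (χ.nat 1 = 0 ↔ G.PassesTest eps k (digitProfile M n k m))) ?_
    (Nat.add_le_add_left (by norm_num : 6 + 1 ≤ 10) _) ?_
  · refine Spec.mono (Spec.chain hn (N := M) (a := 4 * k + 16 * M + 300)
      (fun p χ => χ.Ready M n k eps ∧ χ.nat 2 = 0 ∧
        χ.outputProfile M n = digitProfile M n k m ∧
        (χ.nat 1 = 0 ↔ ∀ i : Fin M, (i : ℕ) < p → ∀ m' < n ^ k,
          G.PassesDeviation eps k (digitProfile M n k m) i m'))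
      le_rfl ⟨k1, k2, k3, by simp [k4]⟩ ?_) (le_of_eq (by ring)) ?_
    · rintro p hp χ ⟨f1, f2, f3, f4⟩
      simp only [dif_pos hp]
      refine (Spec.checkPlayer hn f1 le_rfl).mono le_rfl fun ω hg hω => ?_
      refine ⟨f1.of_framed hg (Program.keepsParameters_checkPlayer _), ?_, ?_, ?_⟩
      · rw [hg.nat _ (by simp [Program.checkPlayer, Program.tryDeviation, Program.load,
          Program.utility, Program.enumerate, Program.increment, Program.incrementDigit,
          Program.forLoop, Program.WritesNat]), f2]
      · rw [← f3]
        funext i s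
        exact congrFun (hg.realArr _ (Program.writesRealArr_checkPlayer i.2)) s
      · rw [hω, f4]
        have : (fun (j : Fin M) (s : Fin n) => χ.realArr j s) = digitProfile M n k m := f3
        rw [this]
        constructor
        · rintro ⟨h, h'⟩ i hi
          rcases Nat.lt_succ_iff_lt_or_eq.1 hi with hi | hi
          · exact h i hi
          · rw [show i = ⟨p, hp⟩ from Fin.ext hi]
            exact h'
        · intro h
          exact ⟨fun i hi => h i (by omega), h ⟨p, hp⟩ (by simp)⟩
    · rintro χ - ⟨-, f2, f3, f4⟩
      refine ⟨f2, f3, f4.trans ?_⟩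
      rw [PenaltyGame.passesTest_iff hn]
      exact ⟨fun h i => h i i.2, fun h i _ => h i⟩
  · rintro χ - ⟨f1, f2, f3⟩
    refine Spec.branch hn (a := 1) (by simp [Test.cost, NatExp.cost]) ?_ ?_
    · intro h
      simp only [Test.Holds, NatExp.eval, Nat.lt_one_iff] at h
      refine Spec.setNat hn (by simp [NatExp.cost]) (.inr ⟨?_, f3.1 h, f2⟩)
      simp [Store.setNat, NatExp.eval]
    · intro h
      simp only [Test.Holds, NatExp.eval, Nat.lt_one_iff] at h
      exact Spec.skip (.inl ⟨f1, fun h' => h (f3.2 h')⟩)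

/-- Test all profiles, until one passes. -/
def Program.search : Program M :=
  .enumerate 0 (.branch (.natLt (.var 2) (.lit 1)) .testProfile .skip)

theorem Program.writesNatArr_testProfile : ¬ (testProfile (M := M)).WritesNatArr 0 := by
  simp only [testProfile, WritesNatArr, not_or, not_false_eq_true, and_true, true_and]
  refine ⟨writesNatArr_chain fun i => ?_, writesNatArr_chain fun i => ?_⟩
  · simp [load, forLoop, WritesNatArr]
  · split_ifs
    · simp [checkPlayer, tryDeviation, load, utility, enumerate, increment, incrementDigit,
        forLoop, WritesNatArr]
    · simp [WritesNatArr]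

/-- Once flag `2` is raised, the remaining rounds do nothing; this keeps the successful profile in
the output arrays although the enumeration runs to its end. -/
theorem Spec.search (hn : 0 < n) {k e : ℕ} {eps : ℝ} {σ : Store}
    (hσ : σ.Ready M n k eps) (h2 : σ.nat 2 = 0)
    (he : M * (8 * k + 20 * M + 350) + 100 ≤ e) :
    Spec G .search σ e fun τ => τ.nat 0 = n ∧
      ((τ.nat 2 = 0 ∧ ∀ m < n ^ (M * k), ¬ G.PassesTest eps k (digitProfile M n k m)) ∨
      (τ.nat 2 = 1 ∧ ∃ m, G.PassesTest eps k (digitProfile M n k m) ∧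
        τ.outputProfile M n = digitProfile M n k m)) := by
  have hkeep := Program.keepsParameters_testProfile (M := M)
  refine Spec.mono (Spec.enumerate hn (D := M * k) (a := M * (5 * k + 20 * M + 350) + 25)
    (fun m τ => τ.Ready M n k eps ∧
      ((τ.nat 2 = 0 ∧ ∀ m' < m, ¬ G.PassesTest eps k (digitProfile M n k m')) ∨
      (τ.nat 2 = 1 ∧ ∃ m', G.PassesTest eps k (digitProfile M n k m') ∧
        τ.outputProfile M n = digitProfile M n k m')))
    ?_ hσ.pureStrategies hσ.profileDigits ?_ ?_ ?_ (le_trans (le_of_eq_of_le (by ring)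
      (show 8 * (M * k) + 20 * M ^ 2 + 350 * M + 85 ≤ M * (8 * k + 20 * M + 350) + 100 by
        ring_nf; omega)) he) ⟨hσ, .inl ⟨h2, by simp⟩⟩ ?_) le_rfl
    fun _ _ h => ⟨h.1.pureStrategies, h.2⟩
  · rintro m τ ρ hs ⟨g1, g2⟩
    refine ⟨g1.of_sameExceptCounter hs, ?_⟩
    have : ρ.outputProfile M n = τ.outputProfile M n := by
      unfold Store.outputProfile; rw [hs.realArr]
    rwa [this, hs.nat 2 (by simp) (by simp)]
  · simpa [Program.WritesNat] using hkeep.1.1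
  · simpa [Program.WritesNat] using hkeep.1.2.1
  · simpa [Program.WritesNatArr] using Program.writesNatArr_testProfile
  · rintro m hm τ - hd ⟨g1, g2⟩
    refine Spec.branch hn (a := M * (5 * k + 20 * M + 350) + 20)
      (by simp only [Test.cost, NatExp.cost]; omega) ?_ ?_
    · intro h
      simp only [Test.Holds, NatExp.eval, Nat.lt_one_iff] at h
      rcases g2 with ⟨-, g2⟩ | ⟨g2, -⟩
      · refine (Spec.testProfile hn g1 hd h le_rfl).mono le_rfl fun ρ hf hρ => ?_
        refine ⟨g1.of_framed hf hkeep, ?_⟩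
        rcases hρ with ⟨h1, h2⟩ | ⟨h1, h2, h3⟩
        · refine .inl ⟨h1, ?_⟩
          rw [Nat.forall_lt_succ_right]
          exact ⟨g2, h2⟩
        · exact .inr ⟨h1, m, h2, h3⟩
      · omega
    · intro h
      simp only [Test.Holds, NatExp.eval, Nat.lt_one_iff] at h
      refine Spec.skip ⟨g1, .inr ?_⟩
      rcases g2 with ⟨g2, -⟩ | g2
      · exact absurd g2 h
      · exact g2

/-! ### The number of samples -/

/-- The real number that is rounded up to the number of samples. -/
noncomputable def sampleThreshold (M n : ℕ) (eps lam : ℝ) : ℝ :=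
  20 * M ^ 3 * (1 + lam * lam) * (1 + 1 / (eps * eps)) * Nat.size n

/-- The number of samples used by the search. -/
noncomputable def sampleCount (M n : ℕ) (eps lam : ℝ) : ℕ := ⌈sampleThreshold M n eps lam⌉₊

theorem one_le_size (hn : 0 < n) : 1 ≤ Nat.size n := Nat.size_pos.2 hn

theorem sampleCount_pos (hM : 0 < M) (hn : 0 < n) {eps lam : ℝ} (heps : 0 < eps) :
    0 < sampleCount M n eps lam := by
  have h1 : (0 : ℝ) < Nat.size n := by exact_mod_cast one_le_size hn
  have h2 : (0 : ℝ) < M := by exact_mod_cast hM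
  have h3 : 0 < 1 + lam * lam := by nlinarith [mul_self_nonneg lam]
  refine Nat.ceil_pos.2 ?_
  unfold sampleThreshold
  positivity

/-- The binary length of `n`, which the machine can compute by doubling, dominates `log (n + 1)`.
The constant `20 = 2 * 5 * 2` comes from `log (4 * M * (n + 1)) ≤ 5 * M * L` and `(M + lam)² ≤ 2 *
M² * (1 + lam²)`. -/
theorem log_le_sampleCount_mul (hM : 0 < M) (hn : 0 < n) {eps lam : ℝ} (heps : 0 < eps)
    (hlam : 0 ≤ lam) :
    2 * Real.log (4 * (M * (n + 1))) ≤ sampleCount M n eps lam * (eps / (M + lam)) ^ 2 := by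
  have hL : (1 : ℝ) ≤ Nat.size n := by exact_mod_cast one_le_size hn
  have hM' : (1 : ℝ) ≤ M := by exact_mod_cast hM
  set L : ℝ := ((Nat.size n : ℕ) : ℝ) with hLdef
  have h1 : Real.log (n + 1) ≤ L := by
    have : ((n : ℝ) + 1) ≤ 2 ^ Nat.size n := by exact_mod_cast Nat.lt_size_self n
    calc Real.log (n + 1) ≤ Real.log (2 ^ Nat.size n) := Real.log_le_log (by positivity) this
      _ = L * Real.log 2 := by rw [Real.log_pow]
      _ ≤ L * 1 := by gcongr; linarith [Real.log_two_lt_d9]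
      _ = L := mul_one _
  have h2 : Real.log (4 * M) ≤ 4 * M := by
    linarith [Real.log_le_sub_one_of_pos (show (0 : ℝ) < 4 * M by positivity)]
  have h3 : Real.log (4 * (M * (n + 1))) ≤ 5 * M * L := by
    rw [← mul_assoc, Real.log_mul (by positivity) (by positivity)]
    nlinarith
  have h4 : sampleThreshold M n eps lam ≤ sampleCount M n eps lam := Nat.le_ceil _
  have h5 : (M + lam) ^ 2 ≤ 2 * M ^ 2 * (1 + lam * lam) := by
    nlinarith [sq_nonneg ((M : ℝ) - lam), mul_self_nonneg lam,
      mul_nonneg (show (0 : ℝ) ≤ M ^ 2 - 1 by nlinarith) (mul_self_nonneg lam)]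
  have h6 : sampleThreshold M n eps lam * eps ^ 2 =
      20 * M ^ 3 * (1 + lam * lam) * L * (eps ^ 2 + 1) := by
    unfold sampleThreshold
    field_simp
    rfl
  rw [div_pow, ← mul_div_assoc, le_div_iff₀ (by positivity)]
  calc 2 * Real.log (4 * (M * (n + 1))) * (M + lam) ^ 2
      ≤ 2 * (5 * M * L) * (2 * M ^ 2 * (1 + lam * lam)) := by gcongr
    _ = 20 * M ^ 3 * (1 + lam * lam) * L * 1 := by ring
    _ ≤ 20 * M ^ 3 * (1 + lam * lam) * L * (eps ^ 2 + 1) := by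
        have := mul_self_nonneg lam
        gcongr
        nlinarith [sq_nonneg eps]
    _ = sampleThreshold M n eps lam * eps ^ 2 := h6.symm
    _ ≤ _ := by gcongr

theorem half_le_log (hn : 0 < n) : 1 / 2 ≤ Real.log (n + 1) := by
  have h : (1 : ℝ) ≤ n := by exact_mod_cast hn
  linarith [Real.log_two_gt_d9, Real.log_le_log (by norm_num) (show (2 : ℝ) ≤ n + 1 by linarith)]

/-- This lower bound lets additive constants be absorbed into the product that appears in the final
exponent. -/
theorem half_le_mul_log (hn : 0 < n) (lam eps : ℝ) :
    1 / 2 ≤ (1 + lam ^ 2) * (1 + 1 / eps ^ 2) * Real.log (n + 1) := by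
  have hl := half_le_log hn
  have hA : 0 ≤ lam ^ 2 := sq_nonneg lam
  have hB : 0 ≤ 1 / eps ^ 2 := by positivity
  have h2 : 1 ≤ (1 + lam ^ 2) * (1 + 1 / eps ^ 2) := by nlinarith [mul_nonneg hA hB]
  nlinarith

/-- From `2 ^ (size - 1) ≤ n` the length is at most `log (n + 1) / log 2 + 1`, and `1 ≤ 2 * log (n +
1)` absorbs the last term. -/
theorem size_le_log (hn : 0 < n) : (Nat.size n : ℝ) ≤ 4 * Real.log (n + 1) := by
  have hs := one_le_size hn
  have h1 : 2 ^ (Nat.size n - 1) ≤ n := Nat.lt_size.1 (by omega)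
  have h2 : (2 : ℝ) ^ (Nat.size n - 1) ≤ n + 1 := by
    exact_mod_cast h1.trans (Nat.le_succ n)
  have h3 := Real.log_le_log (by positivity) h2
  rw [Real.log_pow, Nat.cast_sub hs, Nat.cast_one] at h3
  have h4 : (1 : ℝ) ≤ Nat.size n := by exact_mod_cast hs
  nlinarith [Real.log_two_gt_d9, half_le_log hn]

/-- The factor `80` is `20 * 4`, with `4` from `size_le_log`; the `+ 2` pays for rounding up. -/
theorem sampleCount_le (hn : 0 < n) (eps lam : ℝ) :
    (sampleCount M n eps lam : ℝ) ≤
      (80 * M ^ 3 + 2) * ((1 + lam ^ 2) * (1 + 1 / eps ^ 2) * Real.log (n + 1)) := by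
  have hl := half_le_log hn
  have h0 : 0 ≤ sampleThreshold M n eps lam := by
    unfold sampleThreshold
    rw [← sq, ← sq]
    positivity
  have h1 : sampleThreshold M n eps lam ≤
      80 * M ^ 3 * ((1 + lam ^ 2) * (1 + 1 / eps ^ 2) * Real.log (n + 1)) := by
    unfold sampleThreshold
    rw [← sq, ← sq]
    calc _ ≤ 20 * M ^ 3 * (1 + lam ^ 2) * (1 + 1 / eps ^ 2) * (4 * Real.log (n + 1)) := by
          gcongr
          exact size_le_log hn
      _ = _ := by ring
  have h3 := half_le_mul_log hn lam eps
  have h4 := (Nat.ceil_lt_add_one h0).le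
  unfold sampleCount
  linarith

/-! ### Programs that prepare the parameters -/

/-- Compute in the real variable `2` the binary length of `n`. -/
def Program.binaryLength : Program M :=
  .seq (.setNat 4 (.lit 1)) (.loop (.natLe (.var 4) (.var 0))
    (.seq (.setNat 4 (.add (.var 4) (.var 4))) (.setReal 2 (.add (.var 2) (.lit 1)))))

/-- Compute the number of samples in the natural number variable `dimVar 1` and in the real
variable `3`. -/
def Program.countSamples : Program M :=
  .seq (.setReal 2 (.mul (.mul (.mul (.lit (20 * M ^ 3))
      (.add (.lit 1) (.mul (.var 1) (.var 1))))
      (.add (.lit 1) (.div (.lit 1) (.mul (.var 0) (.var 0))))) (.var 2)))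
    (.loop (.realLt (.var 3) (.var 2))
      (.seq (.setReal 3 (.add (.var 3) (.lit 1)))
        (.setNat (dimVar 1) (.add (.var (dimVar 1)) (.lit 1)))))

/-- Prepare the parameters of the search. -/
def Program.setup : Program M :=
  .seq .binaryLength (.seq .countSamples (.seq (.setNat (dimVar 2) (.lit M))
    (.setNat (dimVar 0) ((NatExp.var (dimVar 1)).nsmul M))))

/-- The doubled variable is `2 ^ m` after `m` rounds, and `2 ^ m ≤ n` holds exactly for `m <
Nat.size n`. -/
theorem Spec.binaryLength (hn : 0 < n) {σ : Store} (h0 : σ.nat 0 = n) (h2 : σ.real 2 = 0) :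
    Spec G .binaryLength σ 14 fun τ => τ.real 2 = Nat.size n := by
  refine Spec.seq hn (a := 1) (b := 12)
    (R := fun τ => τ.nat 4 = 1 ∧ τ.nat 0 = n ∧ τ.real 2 = 0)
    (Spec.setNat hn (by simp [NatExp.cost]) ?_) le_rfl ?_
  · simp [Store.setNat, NatExp.eval, h0, h2]
  rintro τ - ⟨g1, g2, g3⟩
  refine Spec.mono (Spec.loop hn (N := Nat.size n) (h := 1) (a := 7)
    (fun m τ => τ.nat 4 = 2 ^ m ∧ τ.nat 0 = n ∧ τ.real 2 = m) ?_
    (by simp only [Test.cost, NatExp.cost]; omega) (by simp [g1, g2, g3]) ?_ ?_) le_rfl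
    fun _ _ h => h.2.2
  · have := Nat.size_le.2 (Nat.lt_two_pow_self (n := n))
    simpa using this
  · rintro m hm ρ ⟨f1, f2, f3⟩
    refine ⟨by simpa [Test.Holds, NatExp.eval, f1, f2] using Nat.lt_size.1 hm, ?_⟩
    refine Spec.seq hn (a := 3) (b := 3) (R := fun χ => χ = ρ.setNat 4 (2 ^ (m + 1)))
      (Spec.setNat hn (by simp [NatExp.cost]) ?_) le_rfl ?_
    · simp [NatExp.eval, f1, pow_succ, mul_two]
    rintro _ - rfl
    refine Spec.setReal (by simpa [RealExp.cost] using le_pow_self hn 3) ?_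
    simp [Store.setNat, Store.setReal, RealExp.eval, f2, f3]
  · rintro ρ ⟨f1, f2, -⟩
    simpa [Test.Holds, NatExp.eval, f1, f2] using Nat.lt_size_self n

/-- The machine cannot convert between reals and naturals. Counting in both types at once until the
threshold is reached performs the rounding and yields `k` as a natural number, for loop bounds, and
as a real, for `1 / k`. -/
theorem Spec.countSamples (hn : 0 < n) {eps lam : ℝ} {σ : Store} (h0 : σ.real 0 = eps)
    (h1 : σ.real 1 = lam) (h2 : σ.real 2 = Nat.size n) (h3 : σ.real 3 = 0)
    (hk : σ.nat (dimVar 1) = 0) :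
    Spec G .countSamples σ (sampleCount M n eps lam + 50) fun τ =>
      τ.real 3 = sampleCount M n eps lam ∧ τ.nat (dimVar 1) = sampleCount M n eps lam := by
  refine Spec.seq hn (a := 30) (b := sampleCount M n eps lam + 15)
    (R := fun τ => τ.real 2 = sampleThreshold M n eps lam ∧ τ.real 3 = 0 ∧ τ.nat (dimVar 1) = 0)
    (Spec.setReal (le_trans ?_ (le_pow_self hn _)) ?_) (by omega) ?_
  · simp [RealExp.cost]
  · simp [Store.setReal, RealExp.eval, h0, h1, h2, h3, hk, sampleThreshold]
  rintro τ - ⟨g1, g2, g3⟩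
  refine Spec.mono (Spec.loop hn (N := sampleCount M n eps lam) (h := sampleCount M n eps lam)
    (a := 7) (fun m τ => τ.real 2 = sampleThreshold M n eps lam ∧ τ.real 3 = m ∧
      τ.nat (dimVar 1) = m) (le_pow_self hn _)
    (by simp only [Test.cost, RealExp.cost]; omega) (by simp [g1, g2, g3]) ?_ ?_) le_rfl
    fun _ _ h => h.2
  · rintro m hm ρ ⟨f1, f2, f3⟩
    refine ⟨by simpa [Test.Holds, RealExp.eval, f1, f2] using Nat.lt_ceil.1 hm, ?_⟩
    refine Spec.seq hn (a := 3) (b := 3) (R := fun χ => χ = ρ.setReal 3 (m + 1))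
      (Spec.setReal (by simpa [RealExp.cost] using le_pow_self hn 3) ?_) le_rfl ?_
    · simp [RealExp.eval, f2]
    rintro _ - rfl
    refine Spec.setNat hn (by simp [NatExp.cost]) ?_
    simp [Store.setNat, Store.setReal, NatExp.eval, f1, f3]
  · rintro ρ ⟨f1, f2, -⟩
    simpa [Test.Holds, RealExp.eval, f1, f2, sampleCount] using
      Nat.le_ceil (sampleThreshold M n eps lam)

theorem Spec.setup (hn : 0 < n) {eps lam : ℝ} {e : ℕ}
    (he : sampleCount M n eps lam + 2 * M + 80 ≤ e) :
    Spec G .setup (initialStore n eps lam) e fun τ =>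
      τ.Ready M n (sampleCount M n eps lam) eps ∧ τ.nat 2 = 0 := by
  set k := sampleCount M n eps lam with hk
  refine Spec.seq hn (b := k + 2 * M + 60)
    (Spec.binaryLength hn (by simp [initialStore]) (by simp [initialStore])) (by omega) ?_
  intro τ hf hτ
  refine Spec.seq hn (b := 2 * M + 5) (Spec.countSamples (eps := eps) (lam := lam) hn
    ?_ ?_ hτ ?_ ?_) (by omega) ?_
  · rw [hf.real _ (by simp [Program.binaryLength, Program.WritesReal])]; simp [initialStore]
  · rw [hf.real _ (by simp [Program.binaryLength, Program.WritesReal])]; simp [initialStore]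
  · rw [hf.real _ (by simp [Program.binaryLength, Program.WritesReal])]; simp [initialStore]
  · rw [hf.nat _ (by simp [dimVar, Program.binaryLength, Program.WritesNat])]; simp [initialStore]
  rintro ρ hg ⟨h1, h2⟩
  have g0 : ρ.nat 0 = n := by
    rw [hg.nat _ (by simp [Program.countSamples, Program.WritesNat]),
      hf.nat _ (by simp [Program.binaryLength, Program.WritesNat])]
    simp [initialStore]
  have g2 : ρ.nat 2 = 0 := by
    rw [hg.nat _ (by simp [Program.countSamples, Program.WritesNat]),
      hf.nat _ (by simp [Program.binaryLength, Program.WritesNat])]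
    simp [initialStore]
  have g3 : ρ.real 0 = eps := by
    rw [hg.real _ (by simp [Program.countSamples, Program.WritesReal]),
      hf.real _ (by simp [Program.binaryLength, Program.WritesReal])]
    simp [initialStore]
  refine Spec.seq hn (a := 1) (b := 2 * M + 1) (R := fun χ => χ = ρ.setNat (dimVar 2) M)
    (Spec.setNat hn (by simp [NatExp.cost]) (by simp [NatExp.eval])) (by omega) ?_
  rintro _ - rfl
  refine Spec.setNat hn (by simp [NatExp.cost_nsmul, NatExp.cost]; omega)
    ⟨⟨?_, ?_, ?_, ?_, ?_, ?_⟩, ?_⟩ <;>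
    simp [Store.setNat, NatExp.eval_nsmul, NatExp.eval, g0, g2, g3, h1, h2, hk]

/-! ### The complete algorithm -/

/-- Search for a profile that passes the test, and report failure if there is none. -/
def Program.main : Program M :=
  .seq .setup (.seq .search (.branch (.natLt (.var 2) (.lit 1)) (.setNat 0 (.lit 0)) .skip))

theorem Spec.main (hn : 0 < n) {eps lam : ℝ} {k : ℕ} (hk : k = sampleCount M n eps lam) :
    Spec G .main (initialStore n eps lam) ((8 * M + 1) * k + (20 * M ^ 2 + 352 * M + 200))
      fun τ =>
        (τ.SaysNoEquilibrium ∧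
          ∀ m < n ^ (M * k), ¬ G.PassesTest eps k (digitProfile M n k m)) ∨
        (¬ τ.SaysNoEquilibrium ∧ ∃ m, G.PassesTest eps k (digitProfile M n k m) ∧
          τ.outputProfile M n = digitProfile M n k m) := by
  subst hk
  set k := sampleCount M n eps lam
  refine Spec.seq hn (b := M * (8 * k + 20 * M + 350) + 110) (Spec.setup hn le_rfl)
    (by ring_nf; omega) ?_
  rintro τ - ⟨h1, h2⟩
  refine Spec.seq hn (b := 7) (Spec.search hn h1 h2 le_rfl)
    (Nat.add_le_add_left (by norm_num : 100 + 7 + 1 ≤ 110) _) ?_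
  rintro ρ - ⟨g0, hρ⟩
  refine Spec.branch hn (a := 1) (by simp [Test.cost, NatExp.cost]) ?_ ?_
  · intro h
    simp only [Test.Holds, NatExp.eval, Nat.lt_one_iff] at h
    refine Spec.setNat hn (by simp [NatExp.cost]) (.inl ⟨?_, ?_⟩)
    · simp [Store.SaysNoEquilibrium, Store.setNat, NatExp.eval]
    · rcases hρ with ⟨-, hρ⟩ | ⟨hρ, -⟩
      · exact hρ
      · omega
  · intro h
    simp only [Test.Holds, NatExp.eval, Nat.lt_one_iff] at h
    refine Spec.skip (.inr ⟨?_, ?_⟩)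
    -- On success variable `0` still holds `n`, which is nonzero and so announces a profile.
    · rw [Store.SaysNoEquilibrium, g0]
      exact hn.ne'
    · rcases hρ with ⟨hρ, -⟩ | ⟨-, hρ⟩
      · exact absurd hρ h
      · exact hρ

theorem digitProfile_isProfile (hn : 0 < n) {k : ℕ} (hk : 0 < k) (m : ℕ) :
    PenaltyGame.IsProfile (digitProfile M n k m) := fun _ =>
  empirical_mem_stdSimplex hk fun _ _ => Nat.mod_lt _ hn

/-- Concatenate the players' samples: position `j` belongs to player `j / k` and is sample number `j
% k`. This makes the enumeration of digit strings exhaustive for sparse profiles. -/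
theorem exists_digitProfile_eq {k : ℕ} (a : Fin M → ℕ → Fin n) (hk : 0 < k) :
    ∃ m < n ^ (M * k), digitProfile M n k m = fun i => empirical k n fun t => a i t := by
  rcases Nat.eq_zero_or_pos M with rfl | hM
  · exact ⟨0, by simp, funext fun i => i.elim0⟩
  obtain ⟨m, hm, h⟩ := exists_digits_eq (n := n) (D := M * k)
    (fun j => if h : j / k < M then a ⟨j / k, h⟩ (j % k) else 0) (fun j hj => by
      rw [dif_pos ((Nat.div_lt_iff_lt_mul hk).2 hj)]
      exact Fin.is_lt _)
  refine ⟨m, hm, funext fun i => empirical_congr fun j hj => ?_⟩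
  have h1 : (i : ℕ) * k + j < M * k := by
    calc (i : ℕ) * k + j < (i + 1) * k := by rw [add_mul]; omega
      _ ≤ M * k := Nat.mul_le_mul_right _ i.2
  have h2 : ((i : ℕ) * k + j) / k = i := by
    rw [mul_comm, Nat.mul_add_div hk, Nat.div_eq_of_lt hj, add_zero]
  have h3 : ((i : ℕ) * k + j) % k = j := by
    rw [mul_comm, Nat.mul_add_mod, Nat.mod_eq_of_lt hj]
  rw [h _ h1]
  simp only [h2, h3, i.2, dif_pos, Fin.eta]

end PenaltyGames

theorem mainTheorem4 (M : ℕ) (hM : 0 < M) :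
    ∃ (c : PenaltyGames.Program M) (K : ℝ),
      ∀ (n : ℕ) (p lam eps : ℝ) (G : PenaltyGames.PenaltyGame M n),
        0 < n → 2 ≤ p → 0 ≤ lam → 0 < eps →
        (∀ i a, G.payoff i a ∈ Set.Icc (0 : ℝ) 1) →
        (∀ i, PenaltyGames.IsLpLipschitzOn lam p (G.penalty i) (stdSimplex ℝ (Fin n))) →
        ∃ (τ : PenaltyGames.Store) (t : ℕ),
          PenaltyGames.Runs G c (PenaltyGames.initialStore n eps lam) τ t ∧
          (t : ℝ) ≤
            ((n : ℝ) + 1) ^ (K * (1 + lam ^ 2) * (1 + 1 / eps ^ 2) * Real.log ((n : ℝ) + 1)) ∧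
          ((τ.SaysNoEquilibrium ∧ ¬ ∃ x, G.IsEquilibrium x) ∨
            (¬ τ.SaysNoEquilibrium ∧
              G.IsApproxEquilibrium (3 * eps) (τ.outputProfile M n))) := by
  -- The first summand bounds the part of the exponent proportional to `k`; the second bounds its
  -- constant part by means of `1 ≤ 2 * E`.
  refine ⟨.main, (8 * M + 1) * (80 * M ^ 3 + 2) + 2 * (20 * M ^ 2 + 352 * M + 200), ?_⟩
  intro n p lam eps G hn hp hlam heps hG hf
  set k := PenaltyGames.sampleCount M n eps lam with hk
  have hkpos : 0 < k := PenaltyGames.sampleCount_pos hM hn heps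
  have hklog := PenaltyGames.log_le_sampleCount_mul hM hn heps hlam
  obtain ⟨τ, t, hrun, ht, hτ⟩ := PenaltyGames.Spec.main (G := G) hn hk
  refine ⟨τ, t, hrun, ?_, ?_⟩
  · set E := (1 + lam ^ 2) * (1 + 1 / eps ^ 2) * Real.log ((n : ℝ) + 1) with hE
    have hkE : (k : ℝ) ≤ (80 * M ^ 3 + 2) * E := PenaltyGames.sampleCount_le hn eps lam
    have hE2 : 1 / 2 ≤ E := PenaltyGames.half_le_mul_log hn lam eps
    have ht' : (t : ℝ) ≤
        ((n : ℝ) + 1) ^ ((8 * M + 1) * k + (20 * M ^ 2 + 352 * M + 200)) := by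
      exact_mod_cast ht
    refine ht'.trans ?_
    rw [← Real.rpow_natCast]
    refine Real.rpow_le_rpow_of_exponent_le (by linarith [(Nat.cast_nonneg n : (0 : ℝ) ≤ n)]) ?_
    push_cast
    have h3 : (8 * (M : ℝ) + 1) * k ≤ (8 * M + 1) * ((80 * M ^ 3 + 2) * E) := by gcongr
    have h4 : (20 * (M : ℝ) ^ 2 + 352 * M + 200) * 1 ≤
        (20 * (M : ℝ) ^ 2 + 352 * M + 200) * (2 * E) := by
      gcongr
      linarith
    calc _ ≤ (8 * (M : ℝ) + 1) * ((80 * M ^ 3 + 2) * E) +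
          (20 * (M : ℝ) ^ 2 + 352 * M + 200) * (2 * E) := by linarith
      _ = _ := by rw [hE]; ring
  · rcases hτ with ⟨h1, h2⟩ | ⟨h1, m, h2, h3⟩
    · refine .inl ⟨h1, ?_⟩
      rintro ⟨x, hx⟩
      obtain ⟨a, ha⟩ :=
        PenaltyGames.PenaltyGame.exists_passesTest hM hG hp hlam heps hf hklog hkpos hx
      obtain ⟨m, hm, hma⟩ := PenaltyGames.exists_digitProfile_eq a hkpos
      refine h2 m hm ?_
      rw [hma]
      exact ha
    · refine .inr ⟨h1, ?_⟩
      rw [h3]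
      exact PenaltyGames.PenaltyGame.PassesTest.isApproxEquilibrium hM hn hG hp hlam heps hf
        hklog hkpos (PenaltyGames.digitProfile_isProfile hn hkpos m) h2
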